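/- Let $\mathcal H$ be a complex Hilbert space (inner products are linear in the second variable), let $q\in(-1,1)$, and let $\Gamma_q(\mathcal H)$ be the $q$-Fock space, i.e. the completion of the tensor algebra $\bigoplus_{n\ge 0}^{\mathrm{alg}}\mathcal H^{\otimes n}$ in the inner product $$\langle f_1\otimes\dots\otimes f_n,\,g_1\otimes\dots\otimes g_m\rangle_q=\delta_{n,m}\sum_{\pi\in S_n}q^{\mathrm{inv}(\pi)}\prod_{i=1}^n\langle f_i,g_{\pi(i)}\rangle ,$$ where $\mathrm{inv}(\pi)$ is the number of inversions of $\pi$. Let $a^+(f)$ be the bounded operator on $\Gamma_q(\mathcal H)$ given by $a^+(f)x=f\otimes x$, and $a(f)=a^+(f)^*$, so that $a(f)a^+(g)-q\,a^+(g)a(f)=\langle f,g\rangle\mathbf 1$. Let $M_q$ be the weak closure of the unital $*$-algebra generated by $\{a^+(f):f\in\mathcal H\}$. Let $U_t=e^{ith}$ be a weakly continuous one-parameter unitary group on $\mathcal H$ whose self-adjoint (possibly unbounded) generator $h$ is strictly positive, i.e. $\langle x,hx\rangle>0$ for every nonzero $x$ in the domain of $h$. Let $\Gamma_q(U_t)=\bigoplus_n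 U_t^{\otimes n}$ and $\alpha_t(A)=\Gamma_q(U_t)A\,\Gamma_q(U_t)^*$ for $A\in M_q$. Let $\beta>0$ and let $\omega$ be a $\beta$-KMS state on $M_q$ for $\alpha_t$, i.e. a (norm-)continuous linear functional with $\omega(A^*A)\ge 0$ for all $A\in M_q$ and $\omega(\mathbf 1)=1$, such that for all $A,B\in M_q$ there is a function $F$, holomorphic in $0<\operatorname{Im}z<\beta$ and continuous on $0\le\operatorname{Im}z\le\beta$, with $$F(t)=\omega(A\,\alpha_t(B)),\qquad F(t+i\beta)=\omega(\alpha_t(B)\,A)\qquad(t\in\mathbb R).$$ Then $1-qe^{-\beta h}$ has a bounded inverse and, for all $f,g\in\mathcal H$, $$\omega(a(f)a^+(g))=\Big\langle f,\frac{1}{1-qe^{-\beta h}}\,g\Big\rangle,\qquad \omega(a^+(f)a(g))=\Big\langle g,\frac{e^{-\beta h}}{1-qe^{-\beta h}}\,f\Big\rangle .$$ -/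

import Mathlib

open scoped InnerProductSpace ComplexConjugate ComplexOrder Matrix

noncomputable section
namespace QFock
section Form
variable {H : Type*} [NormedAddCommGroup H] [InnerProductSpace ℂ H]

/-- Auxiliary step of the recursion defining `annihAlg`: left multiplication by `g` on the first
component, and the `q`-commutation rule on the second one. -/
def annihStep (q : ℝ) (f g : H) : Module.End ℂ (TensorAlgebra ℂ H × TensorAlgebra ℂ H) where
  toFun p := (TensorAlgebra.ι ℂ g * p.1,
    ⟪f, g⟫_ℂ • p.1 + (q : ℂ) • (TensorAlgebra.ι ℂ g * p.2))
  map_add' p p' := by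
    refine Prod.ext ?_ ?_
    · exact mul_add _ _ _
    · simp only [Prod.fst_add, Prod.snd_add, mul_add, smul_add]; abel
  map_smul' c p := by
    refine Prod.ext ?_ ?_
    · exact mul_smul_comm _ _ _
    · simp only [Prod.smul_fst, Prod.smul_snd, mul_smul_comm, smul_add, RingHom.id_apply]
      rw [smul_comm c ⟪f, g⟫_ℂ, smul_comm c (q : ℂ)]

/-- Auxiliary representation of the tensor algebra: it sends `x` to an operator with
`(1, 0) ↦ (x, a(f) x)`. -/
def annihPair (q : ℝ) (f : H) : TensorAlgebra ℂ H →ₐ[ℂ]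
    Module.End ℂ (TensorAlgebra ℂ H × TensorAlgebra ℂ H) :=
  TensorAlgebra.lift ℂ
    { toFun := annihStep q f
      map_add' := by
        intro g g'
        refine LinearMap.ext fun p => Prod.ext ?_ ?_
        · change TensorAlgebra.ι ℂ (g + g') * p.1 = _ * _ + _ * _
          rw [map_add, add_mul]
        · change ⟪f, g + g'⟫_ℂ • p.1 + (q : ℂ) • (TensorAlgebra.ι ℂ (g + g') * p.2) =
            (_ • _ + _ • _) + (_ • _ + _ • _)
          rw [inner_add_right, add_smul, map_add, add_mul, smul_add]; abel
      map_smul' := by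
        intro c g
        refine LinearMap.ext fun p => Prod.ext ?_ ?_
        · change TensorAlgebra.ι ℂ (c • g) * p.1 = c • (_ * _)
          rw [map_smul, smul_mul_assoc]
        · change ⟪f, c • g⟫_ℂ • p.1 + (q : ℂ) • (TensorAlgebra.ι ℂ (c • g) * p.2) =
            c • (_ • _ + _ • _)
          rw [inner_smul_right, map_smul, smul_mul_assoc, smul_add, mul_smul, smul_comm c (q : ℂ)] }

@[simp] theorem annihPair_ι (q : ℝ) (f g : H) :
    annihPair q f (TensorAlgebra.ι ℂ g) = annihStep q f g := by
  simp [annihPair]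

/-- The annihilation operator `a(f)` on the tensor algebra (the algebraic Fock module). It is the
linear map determined by `a(f) 1 = 0` and `a(f) (g ⊗ x) = ⟨f, g⟩ x + q g ⊗ a(f) x`, see
`annihAlg_one` and `annihAlg_ι_mul`. -/
def annihAlg (q : ℝ) (f : H) : TensorAlgebra ℂ H →ₗ[ℂ] TensorAlgebra ℂ H :=
  LinearMap.snd ℂ _ _ ∘ₗ LinearMap.applyₗ ((1 : TensorAlgebra ℂ H), (0 : TensorAlgebra ℂ H)) ∘ₗ
    (annihPair q f).toLinearMap

theorem tensor_induction {p : TensorAlgebra ℂ H → Prop}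
    (one : p 1) (smul : ∀ (c : ℂ) x, p x → p (c • x)) (add : ∀ x y, p x → p y → p (x + y))
    (ι_mul : ∀ g x, p x → p (TensorAlgebra.ι ℂ g * x)) (x : TensorAlgebra ℂ H) : p x := by
  have key : ∀ y, p y → p (x * y) := by
    induction x using TensorAlgebra.induction with
    | algebraMap r => intro y hy; rw [← Algebra.smul_def]; exact smul r y hy
    | ι g => exact ι_mul g
    | mul a b ha hb => intro y hy; rw [mul_assoc]; exact ha _ (hb _ hy)
    | add a b ha hb => intro y hy; rw [add_mul]; exact add _ _ (ha _ hy) (hb _ hy)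
  simpa using key 1 one

theorem annihPair_fst (q : ℝ) (f : H) (x : TensorAlgebra ℂ H) :
    (annihPair q f x (1, 0)).1 = x := by
  induction x using tensor_induction with
  | one => simp
  | smul c x hx => simp [hx]
  | add x y hx hy => simp [hx, hy]
  | ι_mul g x hx => simp only [map_mul, annihPair_ι, Module.End.mul_apply, annihStep, LinearMap.coe_mk, AddHom.coe_mk, hx]

@[simp] theorem annihAlg_one (q : ℝ) (f : H) : annihAlg q f 1 = 0 := by
  simp [annihAlg]

@[simp] theorem annihAlg_ι_mul (q : ℝ) (f g : H) (x : TensorAlgebra ℂ H) :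
    annihAlg q f (TensorAlgebra.ι ℂ g * x) =
      ⟪f, g⟫_ℂ • x + (q : ℂ) • (TensorAlgebra.ι ℂ g * annihAlg q f x) := by
  have h := annihPair_fst q f x
  simp [annihAlg, annihStep] at h ⊢
  rw [h]

theorem annihAlg_add (q : ℝ) (f g : H) (x : TensorAlgebra ℂ H) :
    annihAlg q (f + g) x = annihAlg q f x + annihAlg q g x := by
  induction x using tensor_induction with
  | one => simp
  | smul c x hx => simp [hx]
  | add x y hx hy => simp only [map_add, hx, hy]; abel
  | ι_mul g x hx => simp only [annihAlg_ι_mul, hx, inner_add_left, add_smul, mul_add, smul_add]; abel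

theorem annihAlg_smul (q : ℝ) (c : ℂ) (f : H) (x : TensorAlgebra ℂ H) :
    annihAlg q (c • f) x = conj c • annihAlg q f x := by
  induction x using tensor_induction with
  | one => simp
  | smul d x hx => simp [hx, smul_comm d]
  | add x y hx hy => simp only [map_add, hx, hy, smul_add]
  | ι_mul g x hx =>
    simp only [annihAlg_ι_mul, hx, inner_smul_left, mul_smul, smul_add, mul_smul_comm]
    rw [smul_comm (q : ℂ)]

/-- The conjugate-linear functional `x ↦ ⟨x, Ω⟩`. -/
def vacuumFunctional : TensorAlgebra ℂ H →ₗ⋆[ℂ] ℂ :=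
  (starLinearEquiv ℂ (A := ℂ)).toLinearMap.comp
    (TensorAlgebra.algebraMapInv (R := ℂ) (M := H)).toLinearMap

/-- The `q`-deformed sesquilinear form on the tensor algebra, `form q y x = ⟨x, y⟩_q`. It is
determined by `⟨Ω, Ω⟩_q = 1`, `a(f) Ω = 0` and `⟨x, g ⊗ y⟩_q = ⟨a(g) x, y⟩_q`. On elementary tensors
`⟨v₁ ⊗ ⋯ ⊗ vₙ, w₁ ⊗ ⋯ ⊗ wₘ⟩_q = δ_{nm} ∑_π q ^ inv π ∏ᵢ ⟨vᵢ, w_{π i}⟩`, see `form_tprod` and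
`form_tprod_of_ne`. -/
def form (q : ℝ) : TensorAlgebra ℂ H →ₗ[ℂ] TensorAlgebra ℂ H →ₗ⋆[ℂ] ℂ :=
  LinearMap.applyₗ (vacuumFunctional (H := H)) ∘ₗ
    (TensorAlgebra.lift ℂ (A := Module.End ℂ (TensorAlgebra ℂ H →ₗ⋆[ℂ] ℂ))
      { toFun := fun g =>
          { toFun := fun φ => φ.comp (annihAlg q g)
            map_add' := fun φ ψ => rfl
            map_smul' := fun c φ => rfl }
        map_add' := by
          intro g g'
          ext φ x
          simp [annihAlg_add]
        map_smul' := by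
          intro c g
          ext φ x
          simp [annihAlg_smul] }).toLinearMap

@[simp] theorem form_one (q : ℝ) (x : TensorAlgebra ℂ H) :
    form q 1 x = conj (TensorAlgebra.algebraMapInv x) := by
  simp [form, vacuumFunctional]

@[simp] theorem form_ι_mul (q : ℝ) (g : H) (x y : TensorAlgebra ℂ H) :
    form q (TensorAlgebra.ι ℂ g * y) x = form q y (annihAlg q g x) := by
  simp [form]

@[simp] theorem algebraMapInv_ι (g : H) :
    TensorAlgebra.algebraMapInv (TensorAlgebra.ι ℂ g) = (0 : ℂ) := by
  simp [TensorAlgebra.algebraMapInv]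

theorem form_symm_ι_mul (q : ℝ) (g : H) (x y : TensorAlgebra ℂ H) :
    form q y (TensorAlgebra.ι ℂ g * x) = form q (annihAlg q g y) x := by
  induction y using tensor_induction generalizing x with
  | one => simp
  | smul c y hy => simp [hy]
  | add y z hy hz => simp [hy, hz]
  | ι_mul k y hy => simp [hy, -Complex.coe_smul]

theorem conj_form (q : ℝ) (x y : TensorAlgebra ℂ H) : conj (form q y x) = form q x y := by
  induction y using tensor_induction generalizing x with
  | one =>
    induction x using tensor_induction with
    | one => simp
    | smul c y hy => simp [← hy]
    | add y z hy hz => simp [← hy, ← hz]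
    | ι_mul k y hy => simp
  | smul c y hy => simp [hy]
  | add y z hy hz => simp [hy, hz]
  | ι_mul k y hy => simp [hy, form_symm_ι_mul]



/-- The weight `q ^ inv π`, where `inv π` is the number of inversions of `π`. -/
def permWeight (q : ℝ) {n : ℕ} (π : Equiv.Perm (Fin n)) : ℝ :=
  ∏ i, ∏ j ∈ Finset.Ioi i, if π j < π i then q else 1

/-- The permutation sending `0` to `k` and `i + 1` to `k.succAbove (e i)`, for `x = (k, e)`. -/
def consPerm {n : ℕ} (x : Fin (n + 1) × Equiv.Perm (Fin n)) : Equiv.Perm (Fin (n + 1)) :=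
  x.1.cycleRange.symm * Equiv.Perm.decomposeFin.symm (0, x.2)

@[simp] theorem consPerm_zero {n : ℕ} (x : Fin (n + 1) × Equiv.Perm (Fin n)) :
    consPerm x 0 = x.1 := by
  simp [consPerm]

@[simp] theorem consPerm_succ {n : ℕ} (x : Fin (n + 1) × Equiv.Perm (Fin n)) (i : Fin n) :
    consPerm x i.succ = x.1.succAbove (x.2 i) := by
  simp [consPerm]

theorem consPerm_bijective (n : ℕ) : Function.Bijective (consPerm (n := n)) := by
  rw [Fintype.bijective_iff_injective_and_card]
  refine ⟨?_, ?_⟩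
  · rintro ⟨k, e⟩ ⟨k', e'⟩ h
    obtain rfl : k = k' := by simpa using DFunLike.congr_fun h 0
    simpa [consPerm] using h
  · simp [Fintype.card_perm, Nat.factorial_succ]

theorem prod_succAbove_lt (q : ℝ) {n : ℕ} (k : Fin (n + 1)) :
    (∏ j : Fin n, if k.succAbove j < k then q else 1) = q ^ (k : ℕ) := by
  simp only [Fin.succAbove_lt_iff_castSucc_lt]
  rw [Finset.prod_ite, Finset.prod_const, Finset.prod_const_one, mul_one]
  congr 1
  have h : (Finset.univ.filter fun x : Fin n => x.castSucc < k).map Fin.castSuccEmb =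
      Finset.Iio k := by
    ext i
    simp only [Finset.mem_map, Finset.mem_filter, Finset.mem_univ, true_and, Finset.mem_Iio]
    constructor
    · rintro ⟨a, ha, rfl⟩
      exact ha
    · intro hi
      exact ⟨i.castPred (Fin.ne_last_of_lt hi), by simpa using hi, by simp⟩
  rw [← Finset.card_map Fin.castSuccEmb, h, Fin.card_Iio]

theorem permWeight_consPerm (q : ℝ) {n : ℕ} (k : Fin (n + 1)) (e : Equiv.Perm (Fin n)) :
    permWeight q (consPerm (k, e)) = q ^ (k : ℕ) * permWeight q e := by
  rw [permWeight, Fin.prod_univ_succ, Fin.prod_Ioi_zero]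
  congr 1
  · simp only [consPerm_zero, consPerm_succ]
    rw [← prod_succAbove_lt, ← Equiv.prod_comp e (fun j => if k.succAbove j < k then q else 1)]
  · simp [permWeight, Fin.prod_Ioi_succ, Fin.succAbove_lt_succAbove_iff]

theorem tprod_succ {n : ℕ} (w : Fin (n + 1) → H) : TensorAlgebra.tprod ℂ H (n + 1) w =
    TensorAlgebra.ι ℂ (w 0) * TensorAlgebra.tprod ℂ H n (fun i => w i.succ) := by
  simp [TensorAlgebra.tprod_apply, List.ofFn_succ]

@[simp] theorem tprod_zero (w : Fin 0 → H) : TensorAlgebra.tprod ℂ H 0 w = 1 := by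
  simp [TensorAlgebra.tprod_apply]

theorem annihAlg_tprod (q : ℝ) (f : H) {n : ℕ} (w : Fin (n + 1) → H) :
    annihAlg q f (TensorAlgebra.tprod ℂ H (n + 1) w) =
      ∑ k : Fin (n + 1), ((q : ℂ) ^ (k : ℕ) * ⟪f, w k⟫_ℂ) •
        TensorAlgebra.tprod ℂ H n (fun i => w (k.succAbove i)) := by
  induction n with
  | zero =>
    rw [tprod_succ, annihAlg_ι_mul]
    simp
  | succ n ih =>
    rw [tprod_succ, annihAlg_ι_mul, ih]
    conv_rhs => rw [Fin.sum_univ_succ]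
    congr 1
    · simp
    · rw [Finset.mul_sum, Finset.smul_sum]
      refine Finset.sum_congr rfl fun k _ => ?_
      rw [tprod_succ]
      simp only [Fin.succ_succAbove_zero, Fin.succ_succAbove_succ, Fin.val_succ, mul_smul_comm,
        smul_smul]
      congr 1
      ring

theorem form_tprod (q : ℝ) {n : ℕ} (v w : Fin n → H) :
    form q (TensorAlgebra.tprod ℂ H n w) (TensorAlgebra.tprod ℂ H n v) =
      ∑ π : Equiv.Perm (Fin n), (permWeight q π : ℂ) * ∏ i, ⟪v i, w (π i)⟫_ℂ := by
  induction n with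
  | zero => simp [permWeight]
  | succ n ih =>
    rw [tprod_succ v, form_symm_ι_mul, annihAlg_tprod, ← (consPerm_bijective n).sum_comp,
      Fintype.sum_prod_type]
    simp only [map_sum, map_smul, LinearMap.sum_apply, LinearMap.smul_apply, ih, smul_eq_mul]
    refine Finset.sum_congr rfl fun k _ => ?_
    rw [Finset.mul_sum]
    refine Finset.sum_congr rfl fun e _ => ?_
    rw [permWeight_consPerm, Fin.prod_univ_succ]
    simp only [consPerm_zero, consPerm_succ]
    push_cast
    ring

theorem form_tprod_of_ne (q : ℝ) {n m : ℕ} (h : n ≠ m) (v : Fin n → H) (w : Fin m → H) :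
    form q (TensorAlgebra.tprod ℂ H m w) (TensorAlgebra.tprod ℂ H n v) = 0 := by
  induction n generalizing m with
  | zero =>
    cases m with
    | zero => exact absurd rfl h
    | succ m => simp [tprod_succ, -TensorAlgebra.tprod_apply]
  | succ n ih =>
    cases m with
    | zero => simp [tprod_succ, -TensorAlgebra.tprod_apply]
    | succ m =>
      rw [tprod_succ v, form_symm_ι_mul, annihAlg_tprod]
      simp [ih (show n ≠ m by omega), -TensorAlgebra.tprod_apply]


theorem prod_perm_comp {n : ℕ} (σ : Equiv.Perm (Fin n)) (f : Fin n → Fin n → ℝ)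
    (hf : ∀ i j, f i j = f j i) :
    ∏ i, ∏ j ∈ Finset.Ioi i, f (σ i) (σ j) = ∏ i, ∏ j ∈ Finset.Ioi i, f i j := by
  simp_rw [Finset.prod_sigma']
  refine Finset.prod_bij' (fun x _ => ⟨σ x.1 ⊓ σ x.2, σ x.1 ⊔ σ x.2⟩)
    (fun x _ => ⟨σ.symm x.1 ⊓ σ.symm x.2, σ.symm x.1 ⊔ σ.symm x.2⟩) ?_ ?_ ?_ ?_ ?_
  · rintro ⟨i, j⟩ h
    have hij : i < j := by simpa using h
    simpa using hij.ne'
  · rintro ⟨i, j⟩ h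
    have hij : i < j := by simpa using h
    simpa using hij.ne'
  · rintro ⟨i, j⟩ h
    have hij : i < j := by simpa using h
    rcases lt_or_ge (σ i) (σ j) with h' | h'
    · simp [inf_eq_left.2 h'.le, sup_eq_right.2 h'.le, inf_eq_left.2 hij.le, sup_eq_right.2 hij.le]
    · simp [inf_eq_right.2 h', sup_eq_left.2 h', inf_eq_right.2 hij.le, sup_eq_left.2 hij.le]
  · rintro ⟨i, j⟩ h
    have hij : i < j := by simpa using h
    rcases lt_or_ge (σ.symm i) (σ.symm j) with h' | h'
    · simp [inf_eq_left.2 h'.le, sup_eq_right.2 h'.le, inf_eq_left.2 hij.le, sup_eq_right.2 hij.le]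
    · simp [inf_eq_right.2 h', sup_eq_left.2 h', inf_eq_right.2 hij.le, sup_eq_left.2 hij.le]
  · rintro ⟨i, j⟩ h
    rcases lt_or_ge (σ i) (σ j) with h' | h'
    · simp [inf_eq_left.2 h'.le, sup_eq_right.2 h'.le]
    · simp [inf_eq_right.2 h', sup_eq_left.2 h', hf (σ i)]

/-- `q` to the number of pairs on which `σ` and `τ` induce different orders. -/
def relWeight (q : ℝ) {n : ℕ} (σ τ : Equiv.Perm (Fin n)) : ℝ :=
  ∏ i, ∏ j ∈ Finset.Ioi i, if (σ i < σ j ↔ τ i < τ j) then 1 else q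

theorem relWeight_mul (q : ℝ) {n : ℕ} (σ π : Equiv.Perm (Fin n)) :
    relWeight q σ (π * σ) = permWeight q π := by
  have h := prod_perm_comp σ (fun i j => if (i < j ↔ π i < π j) then 1 else q) ?_
  · refine Eq.trans (by unfold relWeight; rfl) (h.trans ?_)
    rw [permWeight]
    refine Finset.prod_congr rfl fun i _ => Finset.prod_congr rfl fun j hj => ?_
    have hij : i < j := by simpa using hj
    have hne : π i ≠ π j := fun h => hij.ne (π.injective h)
    rcases lt_or_gt_of_ne hne with h' | h'
    · simp [hij, h', h'.not_gt]
    · simp [hij, h', h'.not_gt]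
  · intro i j
    rcases lt_trichotomy i j with h | rfl | h
    · have hne : π i ≠ π j := fun h' => h.ne (π.injective h')
      rcases lt_or_gt_of_ne hne with h' | h' <;> simp [h, h', h.not_gt, h'.not_gt]
    · rfl
    · have hne : π i ≠ π j := fun h' => h.ne' (π.injective h')
      rcases lt_or_gt_of_ne hne with h' | h' <;> simp [h, h', h.not_gt, h'.not_gt]

theorem posSemidef_prod {α β : Type*} [Finite α] (s : Finset β) (M : β → α → α → ℂ)
    (hM : ∀ b ∈ s, (Matrix.of (M b)).PosSemidef) :
    (Matrix.of fun x y => ∏ b ∈ s, M b x y).PosSemidef := by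
  classical
  have := Fintype.ofFinite α
  induction s using Finset.induction_on with
  | empty =>
    have h := Matrix.posSemidef_vecMulVec_self_star (fun _ : α => (1 : ℂ))
    convert! h using 1
    ext x y
    simp [Matrix.vecMulVec_apply]
  | insert b s hb ih =>
    have h := (hM b (by simp)).hadamard (ih fun c hc => hM c (by simp [hc]))
    convert! h using 1
    ext x y
    simp [Finset.prod_insert hb]

theorem posSemidef_agree {α : Type*} [Finite α] (q : ℝ) (hq : q ∈ Set.Ioo (-1 : ℝ) 1)
    (P : α → Prop) [DecidablePred P] :
    (Matrix.of fun x y : α => ((if (P x ↔ P y) then 1 else q : ℝ) : ℂ)).PosSemidef := by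
  have := Fintype.ofFinite α
  have h1 := (Matrix.posSemidef_vecMulVec_self_star (fun _ : α => (1 : ℂ))).smul
    (show (0 : ℝ) ≤ (1 + q) / 2 by linarith [hq.1])
  have h2 := (Matrix.posSemidef_vecMulVec_self_star
    (fun x : α => if P x then (1 : ℂ) else -1)).smul (show (0 : ℝ) ≤ (1 - q) / 2 by linarith [hq.2])
  convert! h1.add h2 using 1
  ext x y
  by_cases hx : P x <;> by_cases hy : P y <;>
    simp [hx, hy, Matrix.vecMulVec_apply] <;> ring

theorem form_tprod_symmetrized (q : ℝ) {n : ℕ} (v w : Fin n → H) :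
    (n.factorial : ℂ) * form q (TensorAlgebra.tprod ℂ H n w) (TensorAlgebra.tprod ℂ H n v) =
      ∑ σ : Equiv.Perm (Fin n), ∑ τ : Equiv.Perm (Fin n),
        (relWeight q σ τ : ℂ) * ∏ i, ⟪v (σ i), w (τ i)⟫_ℂ := by
  have h : ∀ σ : Equiv.Perm (Fin n), ∑ τ : Equiv.Perm (Fin n),
        (relWeight q σ τ : ℂ) * ∏ i, ⟪v (σ i), w (τ i)⟫_ℂ =
      form q (TensorAlgebra.tprod ℂ H n w) (TensorAlgebra.tprod ℂ H n v) := by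
    intro σ
    rw [form_tprod, ← Equiv.sum_comp (Equiv.mulRight σ)]
    refine Finset.sum_congr rfl fun π _ => ?_
    simp only [Equiv.coe_mulRight, relWeight_mul, Equiv.Perm.mul_apply]
    rw [Equiv.prod_comp σ (fun i => ⟪v i, w (π i)⟫_ℂ)]
  simp [h, Fintype.card_perm, -TensorAlgebra.tprod_apply]

theorem form_self_nonneg_of_mem_span (q : ℝ) (hq : q ∈ Set.Ioo (-1 : ℝ) 1) {n : ℕ}
    {x : TensorAlgebra ℂ H}
    (hx : x ∈ Submodule.span ℂ (Set.range (TensorAlgebra.tprod ℂ H n))) : 0 ≤ form q x x := by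
  obtain ⟨c, rfl⟩ := Finsupp.mem_span_range_iff_exists_finsupp.1 hx
  have hM : (Matrix.of fun a b : c.support × Equiv.Perm (Fin n) =>
      ((relWeight q a.2 b.2 : ℝ) : ℂ) * ∏ i, ⟪a.1.1 (a.2 i), b.1.1 (b.2 i)⟫_ℂ).PosSemidef := by
    have h1 : (Matrix.of fun a b : c.support × Equiv.Perm (Fin n) =>
        ((relWeight q a.2 b.2 : ℝ) : ℂ)).PosSemidef := by
      simp only [relWeight, Complex.ofReal_prod]
      exact posSemidef_prod _ (fun i a b => _) fun i _ =>
        posSemidef_prod _ (fun j a b => _) fun j _ =>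
          posSemidef_agree q hq (fun a : c.support × Equiv.Perm (Fin n) => a.2 i < a.2 j)
    have h2 : (Matrix.of fun a b : c.support × Equiv.Perm (Fin n) =>
        ∏ i, ⟪a.1.1 (a.2 i), b.1.1 (b.2 i)⟫_ℂ).PosSemidef :=
      posSemidef_prod _ (fun i a b => _) fun i _ =>
        Matrix.posSemidef_gram ℂ (fun a : c.support × Equiv.Perm (Fin n) => a.1.1 (a.2 i))
    exact h1.hadamard h2
  have h := hM.dotProduct_mulVec_nonneg (fun a => c a.1.1)
  suffices h' : 0 ≤ (n.factorial : ℂ) * form q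
      (c.sum fun w a => a • TensorAlgebra.tprod ℂ H n w)
      (c.sum fun w a => a • TensorAlgebra.tprod ℂ H n w) by
    have hfac : (0 : ℂ) ≤ (n.factorial : ℂ)⁻¹ := by
      rw [← Complex.ofReal_natCast, ← Complex.ofReal_inv]
      exact_mod_cast inv_nonneg.2 (Nat.cast_nonneg (α := ℝ) n.factorial)
    have := mul_nonneg hfac h'
    rwa [inv_mul_cancel_left₀ (by exact_mod_cast n.factorial_ne_zero)] at this
  convert! h using 1
  simp only [Finsupp.sum, map_sum, map_smul, LinearMap.sum_apply, LinearMap.smul_apply,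
    LinearMap.map_smulₛₗ, smul_eq_mul, dotProduct, Matrix.mulVec, Matrix.of_apply,
    Fintype.sum_prod_type, Pi.star_apply, Finset.mul_sum]
  rw [← Finset.sum_coe_sort c.support]
  refine Finset.sum_congr rfl fun v _ => ?_
  rw [← Finset.sum_coe_sort c.support, Finset.sum_comm]
  refine Finset.sum_congr rfl fun w _ => ?_
  rw [mul_left_comm, mul_left_comm (n.factorial : ℂ), form_tprod_symmetrized, Finset.mul_sum,
    Finset.mul_sum]
  refine Finset.sum_congr rfl fun σ _ => ?_
  rw [Finset.mul_sum, Finset.mul_sum]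
  refine Finset.sum_congr rfl fun τ _ => ?_
  rw [starRingEnd_apply]
  ring

theorem mem_iSup_span_tprod (x : TensorAlgebra ℂ H) :
    x ∈ ⨆ n, Submodule.span ℂ (Set.range (TensorAlgebra.tprod ℂ H n)) := by
  induction x using tensor_induction with
  | one =>
    exact Submodule.mem_iSup_of_mem 0 (Submodule.subset_span ⟨Fin.elim0, tprod_zero _⟩)
  | smul c x hx => exact Submodule.smul_mem _ c hx
  | add x y hx hy => exact Submodule.add_mem _ hx hy
  | ι_mul g x hx =>
    induction hx using Submodule.iSup_induction' with
    | mem n x hx =>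
      refine Submodule.mem_iSup_of_mem (n + 1) ?_
      induction hx using Submodule.span_induction with
      | mem x hx =>
        obtain ⟨w, rfl⟩ := hx
        refine Submodule.subset_span ⟨Fin.cons g w, ?_⟩
        rw [tprod_succ]
        simp
      | zero => simp
      | add x y _ _ hx hy => rw [mul_add]; exact Submodule.add_mem _ hx hy
      | smul c x _ hx => rw [mul_smul_comm]; exact Submodule.smul_mem _ c hx
    | zero => simp
    | add x y _ _ hx hy => rw [mul_add]; exact Submodule.add_mem _ hx hy

theorem form_eq_zero_of_ne (q : ℝ) {n m : ℕ} (h : n ≠ m) {x y : TensorAlgebra ℂ H}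
    (hx : x ∈ Submodule.span ℂ (Set.range (TensorAlgebra.tprod ℂ H n)))
    (hy : y ∈ Submodule.span ℂ (Set.range (TensorAlgebra.tprod ℂ H m))) : form q y x = 0 := by
  induction hx using Submodule.span_induction with
  | mem x hx =>
    obtain ⟨v, rfl⟩ := hx
    induction hy using Submodule.span_induction with
    | mem y hy =>
      obtain ⟨w, rfl⟩ := hy
      exact form_tprod_of_ne q h v w
    | zero => simp
    | add y y' _ _ hy hy' => rw [map_add, LinearMap.add_apply, hy, hy', add_zero]
    | smul c y _ hy => rw [map_smul, LinearMap.smul_apply, hy, smul_zero]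
  | zero => simp
  | add x x' _ _ hx hx' => rw [map_add, hx, hx', add_zero]
  | smul c x _ hx => rw [LinearMap.map_smulₛₗ, hx, smul_zero]

/-- Positivity of the `q`-deformed form. -/
theorem form_self_nonneg (q : ℝ) (hq : q ∈ Set.Ioo (-1 : ℝ) 1) (x : TensorAlgebra ℂ H) :
    0 ≤ form q x x := by
  obtain ⟨f, hf, rfl⟩ := (Submodule.mem_iSup_iff_exists_finsupp _ _).1 (mem_iSup_span_tprod x)
  simp only [Finsupp.sum, map_sum, LinearMap.sum_apply]
  refine Finset.sum_nonneg fun n hn => ?_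
  rw [Finset.sum_eq_single_of_mem n hn fun m _ hmn => form_eq_zero_of_ne q hmn.symm (hf n) (hf m)]
  exact form_self_nonneg_of_mem_span q hq (hf n)


end Form

section Fock

/-- The algebraic `q`-Fock module: the full tensor algebra of `H`, carrying the (positive
semidefinite) `q`-deformed inner product. -/
def AlgFock (_q : Set.Ioo (-1 : ℝ) 1) (H : Type*) [NormedAddCommGroup H] [InnerProductSpace ℂ H] :
    Type _ :=
  TensorAlgebra ℂ H

variable {H : Type*} [NormedAddCommGroup H] [InnerProductSpace ℂ H] {q : Set.Ioo (-1 : ℝ) 1}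

instance : AddCommGroup (AlgFock q H) := inferInstanceAs (AddCommGroup (TensorAlgebra ℂ H))

instance : Module ℂ (AlgFock q H) := inferInstanceAs (Module ℂ (TensorAlgebra ℂ H))

/-- The identity map from the algebraic `q`-Fock module to the tensor algebra. -/
def AlgFock.equiv (q : Set.Ioo (-1 : ℝ) 1) (H : Type*) [NormedAddCommGroup H]
    [InnerProductSpace ℂ H] : AlgFock q H ≃ₗ[ℂ] TensorAlgebra ℂ H :=
  LinearEquiv.refl ℂ _

instance : PreInnerProductSpace.Core ℂ (AlgFock q H) where
  inner x y := form q (AlgFock.equiv q H y) (AlgFock.equiv q H x)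
  conj_inner_symm x y := conj_form q _ _
  re_inner_nonneg x := (Complex.nonneg_iff.1 (form_self_nonneg q q.2 (AlgFock.equiv q H x))).1
  add_left x y z := by rw [map_add, map_add]
  smul_left x y c := by rw [map_smul, LinearMap.map_smulₛₗ]; rfl

instance : SeminormedAddCommGroup (AlgFock q H) :=
  InnerProductSpace.Core.toSeminormedAddCommGroup (𝕜 := ℂ)

instance : InnerProductSpace ℂ (AlgFock q H) := InnerProductSpace.ofCore _

theorem AlgFock.inner_def (x y : AlgFock q H) :
    ⟪x, y⟫_ℂ = form q (AlgFock.equiv q H y) (AlgFock.equiv q H x) := rfl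

/-- The creation operator `x ↦ f ⊗ x` on the algebraic `q`-Fock module. -/
def algCreation (q : Set.Ioo (-1 : ℝ) 1) (f : H) : AlgFock q H →ₗ[ℂ] AlgFock q H :=
  (AlgFock.equiv q H).symm.toLinearMap ∘ₗ
    LinearMap.mulLeft ℂ (TensorAlgebra.ι ℂ f) ∘ₗ (AlgFock.equiv q H).toLinearMap

/-- The annihilation operator on the algebraic `q`-Fock module. -/
def algAnnihilation (q : Set.Ioo (-1 : ℝ) 1) (f : H) : AlgFock q H →ₗ[ℂ] AlgFock q H :=
  (AlgFock.equiv q H).symm.toLinearMap ∘ₗ annihAlg q f ∘ₗ (AlgFock.equiv q H).toLinearMap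

theorem inner_algCreation_left (f : H) (x y : AlgFock q H) :
    ⟪algCreation q f x, y⟫_ℂ = ⟪x, algAnnihilation q f y⟫_ℂ :=
  form_symm_ι_mul (q : ℝ) f _ _

theorem algAnnihilation_algCreation (f g : H) (x : AlgFock q H) :
    algAnnihilation q f (algCreation q g x) =
      ⟪f, g⟫_ℂ • x + ((q : ℝ) : ℂ) • algCreation q g (algAnnihilation q f x) :=
  annihAlg_ι_mul (q : ℝ) f g _

theorem norm_algCreation_sq (f : H) (x : AlgFock q H) :
    ‖algCreation q f x‖ ^ 2 = ‖f‖ ^ 2 * ‖x‖ ^ 2 + q * ‖algAnnihilation q f x‖ ^ 2 := by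
  have h : ((‖algCreation q f x‖ ^ 2 : ℝ) : ℂ) =
      ((‖f‖ ^ 2 * ‖x‖ ^ 2 + q * ‖algAnnihilation q f x‖ ^ 2 : ℝ) : ℂ) := by
    push_cast
    rw [← Complex.coe_algebraMap, ← inner_self_eq_norm_sq_to_K (𝕜 := ℂ)]
    rw [inner_algCreation_left, algAnnihilation_algCreation, inner_add_right, inner_smul_right,
      inner_smul_right, ← inner_conj_symm x (algCreation q f _), inner_algCreation_left]
    simp [inner_self_eq_norm_sq_to_K]
  exact_mod_cast h

theorem exists_pow_algAnnihilation_eq_zero (f : H) (x : AlgFock q H) :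
    ∃ n : ℕ, (algAnnihilation q f ^ n) x = 0 := by
  have hC : ∀ (n : ℕ) (g : H) (x : AlgFock q H), (algAnnihilation q f ^ n) x = 0 →
      (algAnnihilation q f ^ (n + 1)) (algCreation q g x) = 0 := by
    intro n g
    induction n with
    | zero =>
      intro x hx
      have : x = 0 := by simpa using hx
      simp [this]
    | succ n ih =>
      intro x hx
      rw [pow_succ, Module.End.mul_apply, algAnnihilation_algCreation, map_add, map_smul, map_smul,
        hx, ih _ (by rwa [pow_succ, Module.End.mul_apply] at hx)]
      simp
  refine tensor_induction (p := fun x : TensorAlgebra ℂ H =>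
    ∃ n : ℕ, (algAnnihilation q f ^ n) ((AlgFock.equiv q H).symm x) = 0) ?_ ?_ ?_ ?_ x
  · exact ⟨1, annihAlg_one (q : ℝ) f⟩
  · rintro c x ⟨n, hn⟩
    exact ⟨n, by rw [map_smul, map_smul, hn, smul_zero]⟩
  · rintro x y ⟨n, hn⟩ ⟨m, hm⟩
    refine ⟨n + m, ?_⟩
    rw [map_add, map_add]
    conv_lhs => enter [1]; rw [add_comm n m, pow_add, Module.End.mul_apply, hn]
    rw [pow_add, Module.End.mul_apply, hm]
    simp
  · rintro g x ⟨n, hn⟩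
    exact ⟨n + 1, hC n g _ hn⟩

/-- Boundedness of the creation operators. -/
theorem norm_algCreation_le (f : H) (x : AlgFock q H) :
    ‖algCreation q f x‖ ≤ √(‖f‖ ^ 2 / (1 - |(q : ℝ)|)) * ‖x‖ := by
  have hq : 0 < 1 - |(q : ℝ)| := by
    have := abs_lt.2 q.2
    linarith
  set C := ‖f‖ ^ 2 / (1 - |(q : ℝ)|) with hCdef
  have hC0 : 0 ≤ C := by positivity
  have hC : ‖f‖ ^ 2 + |(q : ℝ)| * C = C := by
    rw [hCdef]; field_simp; ring
  have key : ∀ (n : ℕ) (x : AlgFock q H), (algAnnihilation q f ^ n) x = 0 →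
      ‖algCreation q f x‖ ≤ √C * ‖x‖ := by
    intro n
    induction n with
    | zero =>
      intro x hx
      have : x = 0 := by simpa using hx
      simp [this]
    | succ n ih =>
      intro x hx
      have h1 := ih (algAnnihilation q f x) (by rwa [pow_succ, Module.End.mul_apply] at hx)
      have h2 : ‖algAnnihilation q f x‖ ≤ √C * ‖x‖ := by
        have h3 : ‖algAnnihilation q f x‖ ^ 2 ≤
            ‖x‖ * (√C * ‖algAnnihilation q f x‖) := by
          rw [← inner_self_eq_norm_sq (𝕜 := ℂ), ← inner_algCreation_left]
          refine (re_inner_le_norm _ _).trans ?_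
          rw [mul_comm]
          exact mul_le_mul_of_nonneg_left h1 (norm_nonneg _)
        rcases (norm_nonneg (algAnnihilation q f x)).eq_or_lt with h0 | h0
        · rw [← h0]; positivity
        · exact le_of_mul_le_mul_right (by linarith) h0
      have h4 : ‖algAnnihilation q f x‖ ^ 2 ≤ C * ‖x‖ ^ 2 := by
        calc _ ≤ (√C * ‖x‖) ^ 2 := by gcongr
          _ = _ := by rw [mul_pow, Real.sq_sqrt hC0]
      refine abs_le_of_sq_le_sq' ?_ (by positivity) |>.2
      rw [norm_algCreation_sq, mul_pow, Real.sq_sqrt hC0]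
      calc ‖f‖ ^ 2 * ‖x‖ ^ 2 + q * ‖algAnnihilation q f x‖ ^ 2
          ≤ ‖f‖ ^ 2 * ‖x‖ ^ 2 + |(q : ℝ)| * (C * ‖x‖ ^ 2) := by
            gcongr
            exact le_abs_self _
        _ = (‖f‖ ^ 2 + |(q : ℝ)| * C) * ‖x‖ ^ 2 := by ring
        _ = C * ‖x‖ ^ 2 := by rw [hC]
  obtain ⟨n, hn⟩ := exists_pow_algAnnihilation_eq_zero f x
  exact key n x hn

/-- The `q`-Fock space: the metric (Hausdorff) completion of the algebraic `q`-Fock module. -/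
abbrev FockSpace (q : Set.Ioo (-1 : ℝ) 1) (H : Type*) [NormedAddCommGroup H]
    [InnerProductSpace ℂ H] : Type _ :=
  UniformSpace.Completion (AlgFock q H)

/-- The bounded creation operator `a⁺(f)` on the `q`-Fock space. -/
def creation (q : Set.Ioo (-1 : ℝ) 1) (f : H) : FockSpace q H →L[ℂ] FockSpace q H :=
  ((algCreation q f).mkContinuous _ (norm_algCreation_le f)).completion

/-- The bounded annihilation operator `a(f)` on the `q`-Fock space, the adjoint of `a⁺(f)`. -/
def annihilation (q : Set.Ioo (-1 : ℝ) 1) (f : H) : FockSpace q H →L[ℂ] FockSpace q H :=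
  ContinuousLinearMap.adjoint (creation q f)

/-- `⨁ₙ U^{⊗ n}` on the algebraic `q`-Fock module. -/
def algGamma (q : Set.Ioo (-1 : ℝ) 1) (U : H ≃ₗᵢ[ℂ] H) : AlgFock q H →ₗ[ℂ] AlgFock q H :=
  (AlgFock.equiv q H).symm.toLinearMap ∘ₗ
    (TensorAlgebra.lift ℂ (TensorAlgebra.ι ℂ ∘ₗ U.toLinearEquiv.toLinearMap)).toLinearMap ∘ₗ
      (AlgFock.equiv q H).toLinearMap

theorem algGamma_algCreation (U : H ≃ₗᵢ[ℂ] H) (f : H) (x : AlgFock q H) :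
    algGamma q U (algCreation q f x) = algCreation q (U f) (algGamma q U x) := by
  simp [algGamma, algCreation]

theorem AlgFock.induction {p : AlgFock q H → Prop}
    (one : p ((AlgFock.equiv q H).symm 1)) (smul : ∀ (c : ℂ) x, p x → p (c • x))
    (add : ∀ x y, p x → p y → p (x + y))
    (creation : ∀ g x, p x → p (algCreation q g x)) (x : AlgFock q H) : p x :=
  tensor_induction (p := fun x => p ((AlgFock.equiv q H).symm x)) one smul add creation x

theorem algGamma_algAnnihilation (U : H ≃ₗᵢ[ℂ] H) (f : H) (x : AlgFock q H) :
    algGamma q U (algAnnihilation q f x) = algAnnihilation q (U f) (algGamma q U x) := by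
  induction x using AlgFock.induction with
  | one => simp [algGamma, algAnnihilation]
  | smul c x hx => simp [hx]
  | add x y hx hy => simp [hx, hy]
  | creation g x hx =>
    rw [algGamma_algCreation, algAnnihilation_algCreation, algAnnihilation_algCreation, map_add,
      map_smul, map_smul, algGamma_algCreation, hx, U.inner_map_map]

theorem algGamma_comp (U V : H ≃ₗᵢ[ℂ] H) (x : AlgFock q H) :
    algGamma q U (algGamma q V x) = algGamma q (V.trans U) x := by
  induction x using AlgFock.induction with
  | one => simp [algGamma]
  | smul c x hx => simp [hx]
  | add x y hx hy => simp [hx, hy]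
  | creation g x hx => simp only [algGamma_algCreation, hx]; rfl

theorem algGamma_refl (x : AlgFock q H) :
    algGamma q (LinearIsometryEquiv.refl ℂ H) x = x := by
  induction x using AlgFock.induction with
  | one => simp [algGamma]
  | smul c x hx => simp [hx]
  | add x y hx hy => simp [hx, hy]
  | creation g x hx => simp [algGamma_algCreation, hx]

theorem inner_algGamma (U : H ≃ₗᵢ[ℂ] H) (x y : AlgFock q H) :
    ⟪algGamma q U x, algGamma q U y⟫_ℂ = ⟪x, y⟫_ℂ := by
  induction x using AlgFock.induction generalizing y with
  | one =>
    induction y using AlgFock.induction with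
    | one => simp [algGamma]
    | smul c x hx => simp [hx, inner_smul_right]
    | add x y hx hy => simp [hx, hy, inner_add_right]
    | creation g x hx =>
      rw [algGamma_algCreation, ← inner_conj_symm, inner_algCreation_left,
        ← inner_conj_symm _ (algCreation q g x), inner_algCreation_left]
      simp [algGamma, algAnnihilation]
  | smul c x hx => simp [hx, inner_smul_left]
  | add x y hx hy => simp [hx, hy, inner_add_left]
  | creation g x hx =>
    rw [algGamma_algCreation, inner_algCreation_left, inner_algCreation_left,
      ← algGamma_algAnnihilation, hx]

theorem norm_algGamma (U : H ≃ₗᵢ[ℂ] H) (x : AlgFock q H) : ‖algGamma q U x‖ = ‖x‖ := by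
  rw [@norm_eq_sqrt_re_inner ℂ, @norm_eq_sqrt_re_inner ℂ, inner_algGamma]

/-- The second quantisation `Γ_q(U)` of a unitary `U` on the `q`-Fock space. -/
def gamma (q : Set.Ioo (-1 : ℝ) 1) (U : H ≃ₗᵢ[ℂ] H) : FockSpace q H →L[ℂ] FockSpace q H :=
  ((algGamma q U).mkContinuous 1 fun x => by rw [norm_algGamma, one_mul]).completion

end Fock
section WeakClosure
variable {K : Type*} [NormedAddCommGroup K] [InnerProductSpace ℂ K]

/-- The closure of a set of bounded operators in the weak operator topology. -/
def wotClosure (S : Set (K →L[ℂ] K)) : Set (K →L[ℂ] K) :=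
  {A | ContinuousLinearMapWOT.ofCLM A ∈
    closure ((ContinuousLinearMapWOT.ofCLM : (K →L[ℂ] K) → (K →WOT[ℂ] K)) '' S)}

theorem subset_wotClosure (S : Set (K →L[ℂ] K)) : S ⊆ wotClosure S := fun A hA =>
  subset_closure ⟨A, hA, rfl⟩

theorem map_mem_wotClosure {S T : Set (K →L[ℂ] K)} {φ : (K →L[ℂ] K) → (K →L[ℂ] K)}
    (hφ : Continuous fun B : K →WOT[ℂ] K => ContinuousLinearMapWOT.ofCLM (φ B.toCLM))
    (h : ∀ A ∈ S, φ A ∈ wotClosure T) {A : K →L[ℂ] K} (hA : A ∈ wotClosure S) :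
    φ A ∈ wotClosure T := by
  have h1 := map_mem_closure hφ hA (t := closure
    ((ContinuousLinearMapWOT.ofCLM : (K →L[ℂ] K) → (K →WOT[ℂ] K)) '' T)) (by
      rintro _ ⟨B, hB, rfl⟩
      exact h B hB)
  rwa [closure_closure] at h1

variable [CompleteSpace K]

theorem continuous_ofCLM_mul_left (A : K →L[ℂ] K) :
    Continuous fun B : K →WOT[ℂ] K => ContinuousLinearMapWOT.ofCLM (A * B.toCLM) := by
  rw [ContinuousLinearMapWOT.continuous_iff]
  intro x y
  have h : ∀ B : K →WOT[ℂ] K, ⟪y, ContinuousLinearMapWOT.ofCLM (A * B.toCLM) x⟫_ℂ =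
      ⟪ContinuousLinearMap.adjoint A y, B x⟫_ℂ := fun B =>
    (ContinuousLinearMap.adjoint_inner_left A (B x) y).symm
  simp only [h]
  exact (ContinuousLinearMapWOT.continuous_iff.1 continuous_id) x _

theorem continuous_ofCLM_mul_right (A : K →L[ℂ] K) :
    Continuous fun B : K →WOT[ℂ] K => ContinuousLinearMapWOT.ofCLM (B.toCLM * A) := by
  rw [ContinuousLinearMapWOT.continuous_iff]
  intro x y
  exact (ContinuousLinearMapWOT.continuous_iff.1 continuous_id) (A x) y

/-- The weak closure of a unital `*`-algebra of bounded operators, as a `*`-algebra. -/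
def weakClosure (S : StarSubalgebra ℂ (K →L[ℂ] K)) : StarSubalgebra ℂ (K →L[ℂ] K) where
  carrier := wotClosure (S : Set (K →L[ℂ] K))
  mul_mem' := by
    intro A B hA hB
    refine map_mem_wotClosure (φ := fun B => A * B) (continuous_ofCLM_mul_left A) ?_ hB
    intro B hB
    refine map_mem_wotClosure (φ := fun A => A * B) (continuous_ofCLM_mul_right B) ?_ hA
    intro A hA
    exact subset_wotClosure _ (mul_mem hA hB)
  add_mem' := by
    intro A B hA hB
    refine map_mem_wotClosure (φ := fun B => A + B) (continuous_const.add continuous_id) ?_ hB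
    intro B hB
    refine map_mem_wotClosure (φ := fun A => A + B) (continuous_id.add continuous_const) ?_ hA
    intro A hA
    exact subset_wotClosure _ (add_mem hA hB)
  algebraMap_mem' c := subset_wotClosure _ (algebraMap_mem S c)
  star_mem' := by
    intro A hA
    refine map_mem_wotClosure (φ := star) ?_ ?_ hA
    · rw [ContinuousLinearMapWOT.continuous_iff]
      intro x y
      have h : ∀ B : K →WOT[ℂ] K, ⟪y, ContinuousLinearMapWOT.ofCLM (star B.toCLM) x⟫_ℂ =
          conj ⟪x, B y⟫_ℂ := fun B => by
        rw [inner_conj_symm]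
        exact ContinuousLinearMap.adjoint_inner_right B.toCLM y x
      simp only [h]
      exact Complex.continuous_conj.comp
        ((ContinuousLinearMapWOT.continuous_iff.1 continuous_id) y x)
    · intro B hB
      exact subset_wotClosure _ (star_mem hB)

end WeakClosure

section Semigroup
variable {H : Type*} [NormedAddCommGroup H] [InnerProductSpace ℂ H] [CompleteSpace H]

/-- Strict positivity of a (self-adjoint, possibly unbounded) operator: `⟨x, h x⟩ > 0` for every
nonzero `x` in the domain. -/
def IsStrictlyPositive (h : H →ₗ.[ℂ] H) : Prop :=
  ∀ x : h.domain, x ≠ 0 → 0 < (⟪(x : H), h x⟫_ℂ).re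

/-- `1 + h` has a bounded inverse. -/
theorem exists_resolvent {h : H →ₗ.[ℂ] H} (hsa : IsSelfAdjoint h) (hpos : IsStrictlyPositive h) :
    ∃ R : H →L[ℂ] H, ∀ x : H, ∃ hx : R x ∈ h.domain, R x + h ⟨R x, hx⟩ = x := by
  have hnn : ∀ x : h.domain, 0 ≤ (⟪(x : H), h x⟫_ℂ).re := by
    intro x
    by_cases hx : x = 0
    · simp [hx]
    · exact (hpos x hx).le
  let T : h.domain →ₗ[ℂ] H := h.domain.subtype + h.toFun
  have hT : ∀ x : h.domain, T x = x + h x := fun _ => rfl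
  have hbound : ∀ x : h.domain, ‖(x : H)‖ ≤ ‖T x‖ := by
    intro x
    rcases (norm_nonneg (x : H)).eq_or_lt with h0 | h0
    · rw [← h0]; exact norm_nonneg _
    · refine le_of_mul_le_mul_left ?_ h0
      calc ‖(x : H)‖ * ‖(x : H)‖ = (⟪(x : H), (x : H)⟫_ℂ).re := by
            rw [← sq]; exact (inner_self_eq_norm_sq (𝕜 := ℂ) (x : H)).symm
        _ ≤ (⟪(x : H), T x⟫_ℂ).re := by
            rw [hT, inner_add_right, Complex.add_re]; linarith [hnn x]
        _ ≤ ‖(x : H)‖ * ‖T x‖ := re_inner_le_norm (𝕜 := ℂ) _ _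
  have hclosed : IsClosed (LinearMap.range T : Set H) := by
    let G : h.graph →L[ℂ] H :=
      (ContinuousLinearMap.fst ℂ H H + ContinuousLinearMap.snd ℂ H H) ∘L h.graph.subtypeL
    have hG : ∀ p : h.graph, ‖p‖ ≤ (2 : NNReal) * ‖G p‖ := by
      rintro ⟨⟨x, z⟩, hp⟩
      obtain ⟨u, hu, hz⟩ := (LinearPMap.mem_graph_iff h).1 hp
      have hu' : (u : H) = x := hu
      have hz' : h u = z := hz
      have h1 := hbound u
      rw [hT, hu', hz'] at h1
      have h2 : ‖z‖ ≤ ‖x + z‖ + ‖x‖ := by simpa using norm_sub_le (x + z) x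
      change max ‖x‖ ‖z‖ ≤ 2 * ‖x + z‖
      have := norm_nonneg (x + z)
      exact max_le (by linarith) (by linarith)
    have hcomplete : CompleteSpace h.graph :=
      (show IsClosed (h.graph : Set (H × H)) from hsa.isClosed).completeSpace_coe
    have hr := (G.antilipschitz_of_bound hG).isClosed_range G.uniformContinuous
    convert! hr using 1
    ext y
    constructor
    · rintro ⟨x, rfl⟩
      exact ⟨⟨(x, h x), h.mem_graph x⟩, rfl⟩
    · rintro ⟨⟨⟨x, z⟩, hp⟩, rfl⟩
      obtain ⟨u, hu, hz⟩ := (LinearPMap.mem_graph_iff h).1 hp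
      have hu' : (u : H) = x := hu
      have hz' : h u = z := hz
      exact ⟨u, by rw [hT, hu', hz']; rfl⟩
  have hdense : (LinearMap.range T)ᗮ = ⊥ := by
    rw [Submodule.eq_bot_iff]
    intro y hy
    have h1 : ∀ x : h.domain, ⟪-y, (x : H)⟫_ℂ = ⟪y, h x⟫_ℂ := by
      intro x
      have h2 : ⟪y, T x⟫_ℂ = 0 := Submodule.inner_left_of_mem_orthogonal (LinearMap.mem_range_self T x) hy
      rw [hT, inner_add_right] at h2
      rw [inner_neg_left]
      linear_combination -h2
    have h3 : y ∈ h.adjoint.domain := LinearPMap.mem_adjoint_domain_of_exists y ⟨-y, h1⟩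
    have h4 : h.adjoint ⟨y, h3⟩ = -y := LinearPMap.adjoint_apply_eq hsa.dense_domain _ h1
    have h5 : ∃ hy' : y ∈ h.domain, h ⟨y, hy'⟩ = -y := by
      have key : ∀ A : H →ₗ.[ℂ] H, A = h → ∀ hA : y ∈ A.domain, A ⟨y, hA⟩ = -y →
          ∃ hy' : y ∈ h.domain, h ⟨y, hy'⟩ = -y := by
        rintro A rfl hA e
        exact ⟨hA, e⟩
      exact key h.adjoint (LinearPMap.isSelfAdjoint_def.1 hsa) h3 h4
    obtain ⟨hy', h6⟩ := h5
    have h7 := hnn ⟨y, hy'⟩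
    rw [h6, inner_neg_right, Complex.neg_re] at h7
    have h8 : ‖y‖ ^ 2 = (⟪y, y⟫_ℂ).re := (inner_self_eq_norm_sq (𝕜 := ℂ) y).symm
    have h9 : ‖y‖ ^ 2 ≤ 0 := by change 0 ≤ -(⟪y, y⟫_ℂ).re at h7; linarith
    have h10 : ‖y‖ = 0 := by nlinarith [norm_nonneg y]
    exact norm_eq_zero.1 h10
  have hsurj : Function.Surjective T := by
    have := hclosed.completeSpace_coe
    rw [← LinearMap.range_eq_top]
    exact (Submodule.orthogonal_eq_bot_iff).1 hdense
  have hinj : Function.Injective T := by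
    rw [← LinearMap.ker_eq_bot, LinearMap.ker_eq_bot']
    intro x hx
    have := hbound x
    rw [hx, norm_zero] at this
    exact Subtype.ext (norm_le_zero_iff.1 this)
  let e := LinearEquiv.ofBijective T ⟨hinj, hsurj⟩
  refine ⟨(h.domain.subtype ∘ₗ e.symm.toLinearMap).mkContinuous 1 fun x => ?_, fun x => ?_⟩
  · have := hbound (e.symm x)
    rw [show T (e.symm x) = x from e.apply_symm_apply x] at this
    simpa using this
  · exact ⟨(e.symm x).2, e.apply_symm_apply x⟩

/-- The bounded everywhere defined operator `(1 + h)⁻¹`, for a strictly positive self-adjoint `h`.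
Its spectrum lies in `[0, 1]`. -/
def resolventOne {h : H →ₗ.[ℂ] H} (hsa : IsSelfAdjoint h) (hpos : IsStrictlyPositive h) :
    H →L[ℂ] H :=
  (exists_resolvent hsa hpos).choose

/-- The bounded operator `e^{-βh}` (for `β > 0`) of a strictly positive self-adjoint, possibly
unbounded, operator `h`, by the continuous functional calculus: since `h = φ(R)` with `R = (1 + h)⁻¹`
and `φ r = r⁻¹ - 1`, it is `k(R)` where `k r = e^{-β(r⁻¹ - 1)}` for `r > 0`, extended continuously by
`k 0 = 0`. -/
def expNeg (β : ℝ) {h : H →ₗ.[ℂ] H} (hsa : IsSelfAdjoint h) (hpos : IsStrictlyPositive h) :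
    H →L[ℂ] H :=
  cfc (fun r : ℝ => if r ≤ 0 then 0 else Real.exp (-β * (r⁻¹ - 1))) (resolventOne hsa hpos)

/-- A weakly continuous one-parameter unitary group on `H`. -/
structure UnitaryGroup (H : Type*) [NormedAddCommGroup H] [InnerProductSpace ℂ H] where
  toFun : ℝ → H ≃ₗᵢ[ℂ] H
  map_zero' : toFun 0 = LinearIsometryEquiv.refl ℂ H
  map_add' : ∀ s t, toFun (s + t) = (toFun t).trans (toFun s)
  weaklyContinuous' : ∀ x y : H, Continuous fun t => ⟪x, toFun t y⟫_ℂ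

instance : CoeFun (UnitaryGroup H) fun _ => ℝ → H ≃ₗᵢ[ℂ] H := ⟨UnitaryGroup.toFun⟩

/-- The generator `h` of the unitary group `U_t = e^{ith}`: its domain consists of the `x` for which
`t ↦ U_t x` is differentiable at `0`, and `h x = -i (d/dt) U_t x` at `t = 0`. -/
def UnitaryGroup.generator (U : UnitaryGroup H) : H →ₗ.[ℂ] H where
  domain :=
    { carrier := {x | DifferentiableAt ℝ (fun t => U t x) 0}
      add_mem' := fun {x y} hx hy => by
        change DifferentiableAt ℝ (fun t => U t (x + y)) 0
        simpa only [map_add] using DifferentiableAt.fun_add hx hy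
      zero_mem' := by simp
      smul_mem' := fun c x hx => by
        change DifferentiableAt ℝ (fun t => U t (c • x)) 0
        simpa only [map_smul] using DifferentiableAt.fun_const_smul hx c }
  toFun :=
    { toFun := fun x => -Complex.I • deriv (fun t => U t (x : H)) 0
      map_add' := fun x y => by
        simp only [Submodule.coe_add, map_add]
        rw [deriv_fun_add x.2 y.2, smul_add]
      map_smul' := fun c x => by
        simp only [Submodule.coe_smul, map_smul]
        rw [deriv_fun_const_smul c x.2, smul_comm]; rfl }

end Semigroup
section Algebra
variable {H : Type*} [NormedAddCommGroup H] [InnerProductSpace ℂ H]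

theorem gamma_mul_creation (q : Set.Ioo (-1 : ℝ) 1) (U : H ≃ₗᵢ[ℂ] H) (f : H) :
    gamma q U * creation q f = creation q (U f) * gamma q U := by
  ext x
  induction x using UniformSpace.Completion.induction_on with
  | hp => exact isClosed_eq (ContinuousLinearMap.continuous _) (ContinuousLinearMap.continuous _)
  | ih x => simp [gamma, creation, algGamma_algCreation]

theorem gamma_mul_gamma (q : Set.Ioo (-1 : ℝ) 1) (U V : H ≃ₗᵢ[ℂ] H) :
    gamma q U * gamma q V = gamma q (V.trans U) := by
  ext x
  induction x using UniformSpace.Completion.induction_on with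
  | hp => exact isClosed_eq (ContinuousLinearMap.continuous _) (ContinuousLinearMap.continuous _)
  | ih x => simp [gamma, algGamma_comp]

theorem gamma_refl (q : Set.Ioo (-1 : ℝ) 1) : gamma q (LinearIsometryEquiv.refl ℂ H) = 1 := by
  ext x
  induction x using UniformSpace.Completion.induction_on with
  | hp => exact isClosed_eq (ContinuousLinearMap.continuous _) (ContinuousLinearMap.continuous _)
  | ih x => simp [gamma, algGamma_refl]

theorem gamma_symm_mul (q : Set.Ioo (-1 : ℝ) 1) (U : H ≃ₗᵢ[ℂ] H) :
    gamma q U.symm * gamma q U = 1 := by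
  rw [gamma_mul_gamma, LinearIsometryEquiv.self_trans_symm, gamma_refl]

theorem gamma_mul_symm (q : Set.Ioo (-1 : ℝ) 1) (U : H ≃ₗᵢ[ℂ] H) :
    gamma q U * gamma q U.symm = 1 := by
  rw [gamma_mul_gamma, LinearIsometryEquiv.symm_trans_self, gamma_refl]

theorem star_gamma (q : Set.Ioo (-1 : ℝ) 1) (U : H ≃ₗᵢ[ℂ] H) :
    star (gamma q U) = gamma q U.symm := by
  have h : star (gamma q U) * gamma q U = 1 := by
    rw [ContinuousLinearMap.star_eq_adjoint]
    refine ContinuousLinearMap.ext fun x => ext_inner_left ℂ fun y => ?_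
    rw [mul_apply_eq_comp, ContinuousLinearMap.adjoint_inner_right,
      one_apply_eq_self]
    induction x, y using UniformSpace.Completion.induction_on₂ with
    | hp =>
      exact isClosed_eq (by fun_prop) (by fun_prop)
    | ih x y => simp [gamma, inner_algGamma]
  calc star (gamma q U) = star (gamma q U) * (gamma q U * gamma q U.symm) := by
        rw [gamma_mul_symm, mul_one]
    _ = gamma q U.symm := by rw [← mul_assoc, h, one_mul]

/-- The `W*`-algebra `M_q`: the weak closure of the unital `*`-algebra generated by the Fock creation
(and hence annihilation) operators. -/
def qAlgebra (q : Set.Ioo (-1 : ℝ) 1) (H : Type*) [NormedAddCommGroup H] [InnerProductSpace ℂ H] :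
    StarSubalgebra ℂ (FockSpace q H →L[ℂ] FockSpace q H) :=
  weakClosure (StarAlgebra.adjoin ℂ (Set.range (creation (H := H) q)))

/-- `a⁺(f)` as an element of `M_q`. -/
def qCreation (q : Set.Ioo (-1 : ℝ) 1) (f : H) : qAlgebra q H :=
  ⟨creation q f, subset_wotClosure _ (StarAlgebra.subset_adjoin ℂ _ ⟨f, rfl⟩)⟩

/-- `a(f)` as an element of `M_q`. -/
def qAnnihilation (q : Set.Ioo (-1 : ℝ) 1) (f : H) : qAlgebra q H :=
  ⟨annihilation q f, star_mem (qCreation q f).2⟩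

theorem gamma_conj_mem (q : Set.Ioo (-1 : ℝ) 1) (U : H ≃ₗᵢ[ℂ] H)
    {A : FockSpace q H →L[ℂ] FockSpace q H} (hA : A ∈ qAlgebra q H) :
    gamma q U * A * star (gamma q U) ∈ qAlgebra q H := by
  refine map_mem_wotClosure (φ := fun A => gamma q U * A * star (gamma q U)) ?_ ?_ hA
  · exact (continuous_ofCLM_mul_right (star (gamma q U))).comp
      (continuous_ofCLM_mul_left (gamma q U))
  · intro A hA
    refine subset_wotClosure _ ?_
    rw [star_gamma]
    induction hA using StarAlgebra.adjoin_induction with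
    | mem A hA =>
      obtain ⟨f, rfl⟩ := hA
      rw [gamma_mul_creation, mul_assoc, gamma_mul_symm, mul_one]
      exact StarAlgebra.subset_adjoin ℂ _ ⟨U f, rfl⟩
    | algebraMap c =>
      rw [← Algebra.commutes, mul_assoc, gamma_mul_symm, mul_one]
      exact algebraMap_mem _ c
    | add A B _ _ hA hB =>
      rw [mul_add, add_mul]
      exact add_mem hA hB
    | mul A B _ _ hA hB =>
      have h : gamma q U * (A * B) * gamma q U.symm =
          (gamma q U * A * gamma q U.symm) * (gamma q U * B * gamma q U.symm) := by
        calc _ = gamma q U * A * 1 * B * gamma q U.symm := by simp only [mul_assoc, one_mul]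
          _ = _ := by rw [← gamma_symm_mul q U]; simp only [mul_assoc]
      rw [h]
      exact mul_mem hA hB
    | star A _ hA =>
      have h : gamma q U * star A * gamma q U.symm = star (gamma q U * A * gamma q U.symm) := by
        rw [star_mul, star_mul, star_gamma, star_gamma, LinearIsometryEquiv.symm_symm, mul_assoc]
      rw [h]
      exact star_mem hA

/-- The dynamics `α_t(A) = Γ_q(U_t) A Γ_q(U_t)*` on `M_q`. -/
def dynamics (q : Set.Ioo (-1 : ℝ) 1) (U : UnitaryGroup H) (t : ℝ) (A : qAlgebra q H) :
    qAlgebra q H :=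
  ⟨gamma q (U t) * (A : FockSpace q H →L[ℂ] FockSpace q H) * star (gamma q (U t)),
    gamma_conj_mem q (U t) A.2⟩

/-- A continuous linear functional on `M_q` is a state if it is positive and normalised. -/
structure IsState {q : Set.Ioo (-1 : ℝ) 1} (ω : qAlgebra q H →L[ℂ] ℂ) : Prop where
  nonneg : ∀ A : qAlgebra q H, 0 ≤ ω (star A * A)
  map_one : ω 1 = 1

/-- The `β`-KMS condition for a continuous linear functional `ω` on `M_q` and the dynamics `α_t`. -/
def IsKMS {q : Set.Ioo (-1 : ℝ) 1} (U : UnitaryGroup H) (β : ℝ) (ω : qAlgebra q H →L[ℂ] ℂ) :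
    Prop :=
  ∀ A B : qAlgebra q H, ∃ F : ℂ → ℂ,
    DifferentiableOn ℂ F {z | 0 < z.im ∧ z.im < β} ∧
    ContinuousOn F {z | 0 ≤ z.im ∧ z.im ≤ β} ∧
    ∀ t : ℝ, F t = ω (A * dynamics q U t B) ∧ F (t + β * Complex.I) = ω (dynamics q U t B * A)

end Algebra

end QFock
end

/-!
For fixed `f`, the two-point functions `L g = ω(a(f) a⁺(g))` and `M g = ω(a⁺(g) a(f))` are continuous
linear functionals of `g`. Applying `ω` to the `q`-commutation relation gives
`L g - q M g = ⟨f, g⟩`, and the KMS condition gives `L (e^{-βh} g) = M g`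
(`twoPointLeft_comp_expNeg`). Together they say `L ((1 - q e^{-βh}) g) = ⟨f, g⟩`. As `‖e^{-βh}‖ ≤ 1`
and `|q| < 1`, the operator `1 - q e^{-βh}` is invertible, which determines `L` and then `M`.

The KMS identity is formally the substitution `t = iβ` in `ω(a(f) a⁺(e^{ith} g))`. To justify it for
an unbounded `h`, let `R = (1 + h)⁻¹`, a self-adjoint operator with spectrum in `[0, 1]`. On the vectors
`x = max (R - ε) 0 y` the operator `h` agrees with the bounded function `A = 1 / max R ε - 1` of `R`.
Hence `e^{ith} x = exp (itA) x`, by uniqueness for `w' = i h w` (`UnitaryGroup.apply_cutoff`), and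
`exp (-βA) x = e^{-βh} x`, by the functional calculus of `R` (`exp_truncation_mul_cutoff`). So
`z ↦ L (exp (izA) x)` is entire and agrees on the real line with the function supplied by the KMS
condition; by `eq_zero_of_boundary_eq_zero` the two agree at `iβ`. Since `max (R - ε) 0` tends to `R` in
norm as `ε` tends to `0` and `R` has dense range, these vectors suffice (`eq_of_eqOn_cutoff`).
-/

namespace QFock

/-! ### Uniqueness for boundary values on a strip -/

/-- A function which is holomorphic inside a strip, continuous up to the boundary and zero on the real
line is zero near the real line. Near `0` this is the maximum principle on the rectangle
`[-1, 1] × [0, d]` for `K z * exp (-n (z - i d)²)`: the exponential has modulus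
`exp (n ((y - d)² - x²))`, at most `1` on the three sides off the real line, but exponentially large
in `n` on the triangle `|x| < d - y`. -/
theorem eq_zero_of_boundary_eq_zero_of_abs_re_lt {d : ℝ} (hd0 : 0 < d) (hd1 : d ≤ 1) {K : ℂ → ℂ}
    (hd : DifferentiableOn ℂ K {z | 0 < z.im ∧ z.im < d})
    (hc : ContinuousOn K {z | 0 ≤ z.im ∧ z.im ≤ d}) (h0 : ∀ t : ℝ, K t = 0)
    {z : ℂ} (hz0 : 0 < z.im) (hz : |z.re| < d - z.im) : K z = 0 := by
  have hre : ∀ w : ℂ, (-(w - d * Complex.I) ^ 2).re = (w.im - d) ^ 2 - w.re ^ 2 := by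
    intro w
    simp [sq]
  have hcl : closure (Set.Ioo (-1 : ℝ) 1 ×ℂ Set.Ioo 0 d) = Set.Icc (-1 : ℝ) 1 ×ℂ Set.Icc 0 d := by
    rw [Complex.closure_reProdIm, closure_Ioo (by norm_num), closure_Ioo hd0.ne]
  have hsub : Set.Icc (-1 : ℝ) 1 ×ℂ Set.Icc 0 d ⊆ {z | 0 ≤ z.im ∧ z.im ≤ d} := fun w hw =>
    ⟨hw.2.1, hw.2.2⟩
  obtain ⟨M, hM⟩ := (isCompact_Icc.reProdIm isCompact_Icc).exists_bound_of_continuousOn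
    (hc.mono hsub)
  have hM0 : 0 ≤ M := (norm_nonneg _).trans (hM 0 (by simp [Complex.mem_reProdIm, hd0.le]))
  have hbound : ∀ n : ℕ, ‖K z‖ * Real.exp (n * ((z.im - d) ^ 2 - z.re ^ 2)) ≤ M := by
    intro n
    have hnorm : ∀ w, ‖K w * Complex.exp (n * -(w - d * Complex.I) ^ 2)‖ =
        ‖K w‖ * Real.exp (n * ((w.im - d) ^ 2 - w.re ^ 2)) := by
      intro w
      rw [norm_mul, Complex.norm_exp, ← hre, ← Complex.ofReal_natCast, Complex.re_ofReal_mul]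
    rw [← hnorm]
    refine Complex.norm_le_of_forall_mem_frontier_norm_le
      (f := fun w => K w * Complex.exp (n * -(w - d * Complex.I) ^ 2))
      (U := Set.Ioo (-1 : ℝ) 1 ×ℂ Set.Ioo 0 d)
      ((Metric.isBounded_Ioo _ _).reProdIm (Metric.isBounded_Ioo _ _)) ⟨?_, ?_⟩ ?_ ?_
    · exact (hd.mono fun w hw => ⟨hw.2.1, hw.2.2⟩).mul (by fun_prop)
    · rw [hcl]
      exact (hc.mono hsub).mul (by fun_prop)
    · intro w hw
      have hwc := frontier_subset_closure hw
      rw [hcl] at hwc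
      rw [hnorm]
      by_cases hw0 : w.im = 0
      · rw [show w = (w.re : ℂ) from Complex.ext rfl (by simpa using hw0), h0]
        simpa using hM0
      · refine (mul_le_of_le_one_right (norm_nonneg _) ?_).trans (hM w hwc)
        rw [Real.exp_le_one_iff]
        refine mul_nonpos_of_nonneg_of_nonpos (Nat.cast_nonneg n) ?_
        -- The point lies on one of the three sides `im w = d`, `re w = ±1`.
        have hw1 : 0 ≤ w.im ∧ w.im ≤ d := hsub hwc
        rw [Complex.frontier_reProdIm, frontier_Ioo hd0,
          frontier_Ioo (show (-1 : ℝ) < 1 by norm_num)] at hw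
        rcases hw with hw | hw
        · rcases hw.2 with h | h
          · exact absurd h hw0
          · rw [show w.im = d from h]
            nlinarith [sq_nonneg w.re]
        · have h1 : w.re ^ 2 = 1 := by
            rcases hw.1 with h | h
            · rw [show w.re = -1 from h]; norm_num
            · rw [show w.re = 1 from h]; norm_num
          nlinarith
    · refine subset_closure ⟨abs_lt.1 ?_, hz0, ?_⟩
      · linarith
      · change z.im < d
        linarith [abs_nonneg z.re]
  have ha : 0 < (z.im - d) ^ 2 - z.re ^ 2 := by
    rw [← sq_abs z.re]
    nlinarith [abs_nonneg z.re]
  by_contra hK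
  have hK' : 0 < ‖K z‖ := norm_pos_iff.2 hK
  obtain ⟨n, hn⟩ := exists_nat_gt (M / (‖K z‖ * ((z.im - d) ^ 2 - z.re ^ 2)))
  rw [div_lt_iff₀ (by positivity)] at hn
  have h1 := hbound n
  have h2 := mul_le_mul_of_nonneg_left
    (Real.add_one_le_exp (n * ((z.im - d) ^ 2 - z.re ^ 2))) hK'.le
  linarith

/-- A function which is holomorphic inside a strip, continuous up to the boundary and zero on one of
the two boundary lines is zero on the other one: the identity theorem spreads the zeros near the real
line to the whole open strip. -/
theorem eq_zero_of_boundary_eq_zero {β : ℝ} (hβ : 0 < β) {K : ℂ → ℂ}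
    (hd : DifferentiableOn ℂ K {z | 0 < z.im ∧ z.im < β})
    (hc : ContinuousOn K {z | 0 ≤ z.im ∧ z.im ≤ β}) (h0 : ∀ t : ℝ, K t = 0) :
    K (β * Complex.I) = 0 := by
  set d := min 1 β
  have hd0 : 0 < d := lt_min one_pos hβ
  have hopen : IsOpen {z : ℂ | 0 < z.im ∧ z.im < β} :=
    (isOpen_lt continuous_const Complex.continuous_im).inter
      (isOpen_lt Complex.continuous_im continuous_const)
  have hconn : IsPreconnected {z : ℂ | 0 < z.im ∧ z.im < β} :=
    ((convex_Ioo 0 β).linear_preimage Complex.imLm).isPreconnected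
  have hnear : ∀ᶠ z : ℂ in nhds (((d / 2 : ℝ) : ℂ) * Complex.I), K z = 0 := by
    have h1 : IsOpen {z : ℂ | 0 < z.im ∧ |z.re| < d - z.im} :=
      (isOpen_lt continuous_const Complex.continuous_im).inter
        (isOpen_lt Complex.continuous_re.abs (continuous_const.sub Complex.continuous_im))
    filter_upwards [h1.mem_nhds (x := ((d / 2 : ℝ) : ℂ) * Complex.I)
      (by constructor <;> simp <;> linarith)] with z hz
    exact eq_zero_of_boundary_eq_zero_of_abs_re_lt hd0 (min_le_left _ _)
      (hd.mono fun w hw => ⟨hw.1, hw.2.trans_le (min_le_right _ _)⟩)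
      (hc.mono fun w hw => ⟨hw.1, hw.2.trans (min_le_right _ _)⟩) h0 hz.1 hz.2
  have hin := (hd.analyticOnNhd hopen).eqOn_zero_of_preconnected_of_eventuallyEq_zero hconn
    (z₀ := ((d / 2 : ℝ) : ℂ) * Complex.I)
    (by constructor <;> simp <;> linarith [min_le_right 1 β]) hnear
  have hEq : Set.EqOn (fun t : ℝ => K (t * Complex.I)) 0 (Set.Ioo 0 β) := fun t ht =>
    hin (by simpa using ht)
  refine hEq.of_subset_closure (t := Set.Icc 0 β) ?_ continuousOn_const Set.Ioo_subset_Icc_self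
    (by rw [closure_Ioo hβ.ne]) (Set.right_mem_Icc.2 hβ.le)
  exact hc.comp (f := fun t : ℝ => (t : ℂ) * Complex.I) (by fun_prop) fun t ht => by simpa using ht

/-! ### The resolvent `(1 + h)⁻¹` -/

section Resolvent
variable {H : Type*} [NormedAddCommGroup H] [InnerProductSpace ℂ H] [CompleteSpace H]
  {h : H →ₗ.[ℂ] H}

theorem inner_apply_left_of_isSelfAdjoint (hsa : IsSelfAdjoint h) (x y : h.domain) :
    ⟪h x, (y : H)⟫_ℂ = ⟪(x : H), h y⟫_ℂ := by
  have h1 := LinearPMap.adjoint_isFormalAdjoint hsa.dense_domain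
  rw [LinearPMap.isSelfAdjoint_def.1 hsa] at h1
  exact h1 x y

variable (hsa : IsSelfAdjoint h) (hpos : IsStrictlyPositive h)

theorem resolventOne_spec (x : H) : ∃ hx : resolventOne hsa hpos x ∈ h.domain,
    resolventOne hsa hpos x + h ⟨resolventOne hsa hpos x, hx⟩ = x :=
  (exists_resolvent hsa hpos).choose_spec x

/-- Positivity of `h`, written with the resolvent: `⟨Rx, x⟩ = ‖Rx‖² + ⟨Rx, h Rx⟩`. -/
theorem norm_sq_resolventOne_le (x : H) :
    ‖resolventOne hsa hpos x‖ ^ 2 ≤ (⟪resolventOne hsa hpos x, x⟫_ℂ).re := by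
  obtain ⟨hx, e⟩ := resolventOne_spec hsa hpos x
  have hnn : 0 ≤ (⟪resolventOne hsa hpos x, h ⟨resolventOne hsa hpos x, hx⟩⟫_ℂ).re := by
    by_cases h0 : (⟨resolventOne hsa hpos x, hx⟩ : h.domain) = 0
    · rw [h0]; simp
    · exact (hpos _ h0).le
  have h1 : (⟪resolventOne hsa hpos x, resolventOne hsa hpos x⟫_ℂ).re =
      ‖resolventOne hsa hpos x‖ ^ 2 := inner_self_eq_norm_sq (𝕜 := ℂ) _
  have h2 := congrArg (fun y => (⟪resolventOne hsa hpos x, y⟫_ℂ).re) e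
  simp only [inner_add_right, Complex.add_re, h1] at h2
  linarith

theorem norm_resolventOne_le : ‖resolventOne hsa hpos‖ ≤ 1 := by
  refine ContinuousLinearMap.opNorm_le_bound _ zero_le_one fun x => ?_
  have h1 := (norm_sq_resolventOne_le hsa hpos x).trans (re_inner_le_norm (𝕜 := ℂ) _ _)
  rw [one_mul]
  by_contra! h2
  nlinarith [norm_nonneg x]

theorem isPositive_resolventOne : (resolventOne hsa hpos).IsPositive := by
  refine ContinuousLinearMap.isPositive_def'.2 ⟨?_, fun x => ?_⟩
  · rw [ContinuousLinearMap.isSelfAdjoint_iff_isSymmetric]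
    intro x y
    obtain ⟨hx, ex⟩ := resolventOne_spec hsa hpos x
    obtain ⟨hy, ey⟩ := resolventOne_spec hsa hpos y
    change ⟪resolventOne hsa hpos x, y⟫_ℂ = ⟪x, resolventOne hsa hpos y⟫_ℂ
    have h1 := congrArg (fun z => ⟪resolventOne hsa hpos x, z⟫_ℂ) ey
    have h2 := congrArg (fun z => ⟪z, resolventOne hsa hpos y⟫_ℂ) ex
    simp only [inner_add_left, inner_add_right] at h1 h2
    rw [← h1, ← h2]
    congr 1
    exact (inner_apply_left_of_isSelfAdjoint hsa ⟨_, hx⟩ ⟨_, hy⟩).symm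
  · exact (sq_nonneg _).trans (norm_sq_resolventOne_le hsa hpos x)

theorem isSelfAdjoint_resolventOne : IsSelfAdjoint (resolventOne hsa hpos) :=
  (isPositive_resolventOne hsa hpos).isSelfAdjoint

theorem mem_Icc_of_mem_spectrum_resolventOne {r : ℝ}
    (hr : r ∈ spectrum ℝ (resolventOne hsa hpos)) : r ∈ Set.Icc (0 : ℝ) 1 := by
  refine ⟨spectrum_nonneg_of_nonneg
    ((ContinuousLinearMap.nonneg_iff_isPositive _).2 (isPositive_resolventOne hsa hpos)) hr, ?_⟩
  have : Nontrivial (H →L[ℂ] H) := by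
    by_contra hn
    rw [not_nontrivial_iff_subsingleton] at hn
    simp [spectrum.of_subsingleton] at hr
  exact (Real.le_norm_self r).trans
    ((spectrum.norm_le_norm_of_mem hr).trans (norm_resolventOne_le hsa hpos))

/-- `R` is self-adjoint and injective, so its range has trivial orthogonal complement. -/
theorem denseRange_resolventOne : DenseRange (resolventOne hsa hpos) := by
  have h1 : Dense ((resolventOne hsa hpos).range : Set H) := by
    rw [Submodule.dense_iff_topologicalClosure_eq_top, Submodule.topologicalClosure_eq_top_iff,
      Submodule.eq_bot_iff]
    intro y hy
    have h2 : resolventOne hsa hpos y = 0 := by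
      refine ext_inner_right ℂ fun x => ?_
      rw [inner_zero_left]
      refine Eq.trans ?_ (Submodule.inner_left_of_mem_orthogonal (LinearMap.mem_range_self _ x) hy)
      exact (isPositive_resolventOne hsa hpos).isSymmetric y x
    obtain ⟨hy', e⟩ := resolventOne_spec hsa hpos y
    have h3 : (⟨resolventOne hsa hpos y, hy'⟩ : h.domain) = 0 := Subtype.ext h2
    rw [h3, h2, LinearPMap.map_zero, add_zero] at e
    exact e.symm
  exact h1

/-! ### Spectral truncation of `h` -/

/-- The bounded truncation of `h = R⁻¹ - 1`, where `R = (1 + h)⁻¹`: the function `1 / max r ε - 1` of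
`R`. -/
noncomputable def truncation (ε : ℝ) : H →L[ℂ] H :=
  cfc (fun r : ℝ => (max r ε)⁻¹ - 1) (resolventOne hsa hpos)

/-- The function `max (r - ε) 0` of `R = (1 + h)⁻¹`. Its range consists of vectors on which `h` agrees
with its truncation. -/
noncomputable def cutoff (ε : ℝ) : H →L[ℂ] H :=
  cfc (fun r : ℝ => max (r - ε) 0) (resolventOne hsa hpos)

theorem continuous_truncation_symbol {ε : ℝ} (hε : 0 < ε) :
    Continuous fun r : ℝ => (max r ε)⁻¹ - 1 :=
  ((continuous_id.max continuous_const).inv₀ fun _ => (lt_max_of_lt_right hε).ne').sub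
    continuous_const

/-- The identity `R (1 + A) P = P` for the truncation `A` and the cutoff `P`: on the support of
`max (r - ε) 0` one has `r * (1 / max r ε) = 1`. It puts the range of `P` into the domain of `h`. -/
theorem resolventOne_mul_cutoff {ε : ℝ} (hε : 0 < ε) :
    resolventOne hsa hpos * (cutoff hsa hpos ε + truncation hsa hpos ε * cutoff hsa hpos ε) =
      cutoff hsa hpos ε := by
  have hR := isSelfAdjoint_resolventOne hsa hpos
  have hc := continuous_truncation_symbol hε
  have h1 : cfc (fun r : ℝ => r * (max (r - ε) 0 + ((max r ε)⁻¹ - 1) * max (r - ε) 0))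
      (resolventOne hsa hpos) = cutoff hsa hpos ε := by
    refine cfc_congr fun r _ => ?_
    rcases le_total r ε with h | h
    · simp [h]
    · have : r ≠ 0 := (hε.trans_le h).ne'
      simp only [max_eq_left h, max_eq_left (sub_nonneg.2 h)]
      field_simp
      ring
  rw [cfc_mul (fun r : ℝ => r) (fun r => max (r - ε) 0 + ((max r ε)⁻¹ - 1) * max (r - ε) 0) _
      (by fun_prop) (Continuous.add (by fun_prop) (hc.mul (by fun_prop))).continuousOn,
    cfc_add _ (fun r : ℝ => max (r - ε) 0) (fun r : ℝ => ((max r ε)⁻¹ - 1) * max (r - ε) 0)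
      (by fun_prop) (hc.mul (by fun_prop)).continuousOn,
    cfc_mul (fun r : ℝ => (max r ε)⁻¹ - 1) _ _ hc.continuousOn (by fun_prop), cfc_id' ℝ _ hR] at h1
  exact h1

theorem apply_cutoff {ε : ℝ} (hε : 0 < ε) (y : H) :
    ∃ hy : cutoff hsa hpos ε y ∈ h.domain,
      h ⟨cutoff hsa hpos ε y, hy⟩ = truncation hsa hpos ε (cutoff hsa hpos ε y) := by
  have h1 := DFunLike.congr_fun (resolventOne_mul_cutoff hsa hpos hε) y
  obtain ⟨hy, e⟩ := resolventOne_spec hsa hpos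
    (cutoff hsa hpos ε y + truncation hsa hpos ε (cutoff hsa hpos ε y))
  have h2 : resolventOne hsa hpos
      (cutoff hsa hpos ε y + truncation hsa hpos ε (cutoff hsa hpos ε y)) = cutoff hsa hpos ε y := h1
  simp only [h2, add_right_inj] at e
  exact ⟨h2 ▸ hy, e⟩

theorem commute_truncation_cutoff (ε : ℝ) :
    Commute (truncation hsa hpos ε) (cutoff hsa hpos ε) :=
  cfc_commute_cfc _ _ _

/-- Continuity on all of `ℝ` of the function defining `e^{-βh}`, which makes `expNeg` a genuine value of
the functional calculus. -/
theorem continuous_expNeg_symbol {β : ℝ} (hβ : 0 < β) :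
    Continuous fun r : ℝ => if r ≤ 0 then 0 else Real.exp (-β * (r⁻¹ - 1)) := by
  rw [continuous_iff_continuousAt]
  intro r
  rcases lt_trichotomy r 0 with h | rfl | h
  · refine continuousAt_const.congr (f := fun _ => (0 : ℝ)) ?_
    filter_upwards [Iio_mem_nhds h] with s hs
    rw [if_pos (le_of_lt hs)]
  · rw [continuousAt_iff_continuous_left'_right']
    constructor
    · refine continuousWithinAt_const.congr (f := fun _ => (0 : ℝ)) ?_ ?_
      · intro s hs
        exact if_pos (le_of_lt hs)
      · simp
    · have h1 : Filter.Tendsto (fun r : ℝ => Real.exp (-β * (r⁻¹ - 1)))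
          (nhdsWithin 0 (Set.Ioi 0)) (nhds 0) := by
        refine Real.tendsto_exp_atBot.comp ?_
        refine Filter.Tendsto.const_mul_atTop_of_neg (neg_lt_zero.2 hβ) ?_
        exact Filter.tendsto_atTop_add_const_right _ _ tendsto_inv_nhdsGT_zero
      rw [ContinuousWithinAt, if_pos le_rfl]
      refine h1.congr' ?_
      filter_upwards [self_mem_nhdsWithin] with s hs
      rw [if_neg (not_le.2 hs)]
  · refine ContinuousAt.congr (f := fun r : ℝ => Real.exp (-β * (r⁻¹ - 1))) ?_ ?_
    · have := h.ne'
      fun_prop (disch := assumption)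
    · filter_upwards [Ioi_mem_nhds h] with s hs
      rw [if_neg (not_le.2 hs)]

theorem norm_expNeg_le {β : ℝ} (hβ : 0 < β) : ‖expNeg β hsa hpos‖ ≤ 1 := by
  refine norm_cfc_le zero_le_one fun r hr => ?_
  obtain ⟨h0, h1⟩ := mem_Icc_of_mem_spectrum_resolventOne hsa hpos hr
  split_ifs with h
  · simp
  · rw [Real.norm_eq_abs, Real.abs_exp, Real.exp_le_one_iff]
    have : 1 ≤ r⁻¹ := (one_le_inv₀ (not_le.1 h)).2 h1
    nlinarith

/-- On the support of `max (r - ε) 0` the function defining `e^{-βh}` is `exp (-β (1 / max r ε - 1))`. -/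
theorem exp_truncation_mul_cutoff {β ε : ℝ} (hβ : 0 < β) (hε : 0 < ε) :
    NormedSpace.exp ((-β : ℝ) • truncation hsa hpos ε) * cutoff hsa hpos ε =
      expNeg β hsa hpos * cutoff hsa hpos ε := by
  have hR := isSelfAdjoint_resolventOne hsa hpos
  have hc := continuous_truncation_symbol hε
  have hc1 : Continuous fun r : ℝ => -β * ((max r ε)⁻¹ - 1) := continuous_const.mul hc
  have hA : (-β : ℝ) • truncation hsa hpos ε =
      cfc (fun r : ℝ => -β * ((max r ε)⁻¹ - 1)) (resolventOne hsa hpos) :=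
    (cfc_const_mul (-β) (fun r : ℝ => (max r ε)⁻¹ - 1) _ hc.continuousOn).symm
  rw [hA, ← CFC.real_exp_eq_normedSpace_exp (cfc_predicate _ _),
    ← cfc_comp' Real.exp (fun r : ℝ => -β * ((max r ε)⁻¹ - 1)) _ (by fun_prop)
      hc1.continuousOn hR,
    cutoff, expNeg, ← cfc_mul (fun r : ℝ => Real.exp (-β * ((max r ε)⁻¹ - 1))) _ _
      (Real.continuous_exp.comp hc1).continuousOn (by fun_prop),
    ← cfc_mul _ _ _ (continuous_expNeg_symbol hβ).continuousOn (by fun_prop)]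
  refine cfc_congr fun r _ => ?_
  rcases le_total r ε with h | h
  · simp [h]
  · simp [h, hε.trans_le h]

theorem norm_cutoff_sub_resolventOne_le {ε : ℝ} (hε : 0 < ε) :
    ‖cutoff hsa hpos ε - resolventOne hsa hpos‖ ≤ ε := by
  have hR := isSelfAdjoint_resolventOne hsa hpos
  have h1 : cutoff hsa hpos ε - resolventOne hsa hpos =
      cfc (fun r : ℝ => max (r - ε) 0 - r) (resolventOne hsa hpos) := by
    rw [cfc_sub _ _ _ (by fun_prop) (by fun_prop), cfc_id' ℝ _ hR, cutoff]
  rw [h1]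
  refine norm_cfc_le hε.le fun r hr => ?_
  obtain ⟨h0, -⟩ := mem_Icc_of_mem_spectrum_resolventOne hsa hpos hr
  rw [Real.norm_eq_abs, abs_le]
  rcases le_total r ε with h | h
  · rw [max_eq_right (by linarith)]; constructor <;> linarith
  · rw [max_eq_left (by linarith)]; constructor <;> linarith

/-- The vectors `cutoff ε y`, for `ε > 0`, are total: as `ε` tends to `0` they tend to `R y`, and `R` has
dense range. -/
theorem eq_of_eqOn_cutoff {A B : H →L[ℂ] ℂ}
    (hAB : ∀ ε > 0, ∀ y, A (cutoff hsa hpos ε y) = B (cutoff hsa hpos ε y)) : A = B := by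
  refine ContinuousLinearMap.coeFn_injective
    ((denseRange_resolventOne hsa hpos).equalizer A.continuous B.continuous ?_)
  ext y
  have hlim : Filter.Tendsto (fun ε => cutoff hsa hpos ε y) (nhdsWithin 0 (Set.Ioi 0))
      (nhds (resolventOne hsa hpos y)) := by
    rw [tendsto_iff_norm_sub_tendsto_zero]
    refine squeeze_zero' (g := fun ε => ε * ‖y‖) (Filter.Eventually.of_forall fun _ => norm_nonneg _)
      ?_ ?_
    · filter_upwards [self_mem_nhdsWithin] with ε hε
      exact (cutoff hsa hpos ε - resolventOne hsa hpos).le_of_opNorm_le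
        (norm_cutoff_sub_resolventOne_le hsa hpos hε) y
    · refine tendsto_nhdsWithin_of_tendsto_nhds ?_
      exact (by fun_prop : Continuous fun ε : ℝ => ε * ‖y‖).tendsto' _ _ (zero_mul _)
  refine tendsto_nhds_unique ((A.continuous.tendsto _).comp hlim) ?_
  refine ((B.continuous.tendsto _).comp hlim).congr' ?_
  filter_upwards [self_mem_nhdsWithin] with ε hε
  exact (hAB ε hε y).symm

/-! ### The unitary group on truncated vectors -/

end Resolvent

section Group
variable {H : Type*} [NormedAddCommGroup H] [InnerProductSpace ℂ H]

theorem UnitaryGroup.hasDerivAt (U : UnitaryGroup H) (x : U.generator.domain) (t : ℝ) :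
    HasDerivAt (fun s => U s (x : H)) (Complex.I • U t (U.generator x)) t := by
  have h0 : HasDerivAt (fun s => U s (x : H)) (Complex.I • U.generator x) (t - t) := by
    have h1 : Complex.I • U.generator x = deriv (fun s => U s (x : H)) 0 := by
      change Complex.I • -Complex.I • deriv (fun s => U s (x : H)) 0 = _
      rw [smul_smul]
      simp
    rw [sub_self, h1]
    exact DifferentiableAt.hasDerivAt x.2
  have h2 := (h0.comp_sub_const t t)
  have h3 := ((U t).toContinuousLinearEquiv.toContinuousLinearMap.restrictScalars ℝ).hasFDerivAt
    |>.comp_hasDerivAt t h2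
  -- `U_s = U_t U_{s - t}` reduces the derivative at `t` to the one at `0`.
  have h4 : (fun s => U s (x : H)) = fun s => U t (U (s - t) (x : H)) := by
    funext s
    have := U.map_add' t (s - t)
    rw [add_sub_cancel] at this
    exact DFunLike.congr_fun this (x : H)
  rw [h4]
  convert! h3 using 1
  exact (map_smul (U t) _ _).symm

theorem UnitaryGroup.apply_mem_domain (U : UnitaryGroup H) (x : U.generator.domain) (t : ℝ) :
    ∃ ht : U t (x : H) ∈ U.generator.domain,
      U.generator ⟨U t (x : H), ht⟩ = U t (U.generator x) := by
  have h0 : HasDerivAt (fun s => U s (U t (x : H))) (Complex.I • U t (U.generator x)) 0 := by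
    have h1 := U.hasDerivAt x (0 + t)
    have h2 := h1.comp_add_const 0 t
    rw [zero_add] at h2
    convert! h2 using 1
    funext s
    exact (DFunLike.congr_fun (U.map_add' s t) (x : H)).symm
  refine ⟨h0.differentiableAt, ?_⟩
  change -Complex.I • deriv (fun s => U s (U t (x : H))) 0 = _
  rw [h0.deriv, smul_smul]
  simp

end Group

section Resolvent
variable {H : Type*} [NormedAddCommGroup H] [InnerProductSpace ℂ H] [CompleteSpace H]

/-- Uniqueness for the Schrödinger equation `w' = i h w`: its difference from `U_t w(0)` has constant
norm, as `h` is symmetric. -/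
theorem UnitaryGroup.eq_of_hasDerivAt (U : UnitaryGroup H) (hU : IsSelfAdjoint U.generator)
    {w : ℝ → H} (hw : ∀ t, ∃ ht : w t ∈ U.generator.domain,
      HasDerivAt w (Complex.I • U.generator ⟨w t, ht⟩) t) (t : ℝ) : U t (w 0) = w t := by
  obtain ⟨h0, -⟩ := hw 0
  have hv : ∀ s, HasDerivAt (fun s => ⟪U s (w 0) - w s, U s (w 0) - w s⟫_ℂ) 0 s := by
    intro s
    obtain ⟨hs, hd⟩ := hw s
    obtain ⟨hs', e⟩ := U.apply_mem_domain ⟨w 0, h0⟩ s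
    have h1 := (U.hasDerivAt ⟨w 0, h0⟩ s).sub hd
    have h2 : U.generator (⟨U s (w 0), hs'⟩ - ⟨w s, hs⟩) =
        U s (U.generator ⟨w 0, h0⟩) - U.generator ⟨w s, hs⟩ := by
      rw [LinearPMap.map_sub, e]
    have h3 := inner_apply_left_of_isSelfAdjoint hU (⟨U s (w 0), hs'⟩ - ⟨w s, hs⟩)
      (⟨U s (w 0), hs'⟩ - ⟨w s, hs⟩)
    rw [h2, AddSubgroupClass.coe_sub] at h3
    convert! h1.inner ℂ h1 using 1
    rw [← smul_sub, inner_smul_right, inner_smul_left, Pi.sub_apply, Complex.conj_I, h3]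
    ring
  have hconst := is_const_of_deriv_eq_zero (fun s => (hv s).differentiableAt)
    (fun s => (hv s).deriv) t 0
  have h00 : U 0 (w 0) = w 0 := DFunLike.congr_fun U.map_zero' (w 0)
  simp only [h00, sub_self, inner_zero_left, inner_self_eq_zero] at hconst
  exact sub_eq_zero.1 hconst

/-- On the range of the cutoff, `U_t = e^{ith}` is the exponential of the bounded truncation of
`h`. -/
theorem UnitaryGroup.apply_cutoff (U : UnitaryGroup H) (hsa : IsSelfAdjoint U.generator)
    (hpos : IsStrictlyPositive U.generator) {ε : ℝ} (hε : 0 < ε) (y : H) (t : ℝ) :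
    U t (cutoff hsa hpos ε y) =
      NormedSpace.exp ((t : ℂ) • Complex.I • truncation hsa hpos ε) (cutoff hsa hpos ε y) := by
  set A := truncation hsa hpos ε
  set P := cutoff hsa hpos ε
  have hcomm : ∀ s : ℝ, NormedSpace.exp ((s : ℂ) • Complex.I • A) * P =
      P * NormedSpace.exp ((s : ℂ) • Complex.I • A) := fun s =>
    (((commute_truncation_cutoff hsa hpos ε).smul_left _).smul_left _).exp_left
  have key := U.eq_of_hasDerivAt hsa
    (w := fun s : ℝ => NormedSpace.exp ((s : ℂ) • Complex.I • A) (P y)) ?_ t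
  · simpa using key
  · intro s
    have e : NormedSpace.exp ((s : ℂ) • Complex.I • A) (P y) =
        P (NormedSpace.exp ((s : ℂ) • Complex.I • A) y) := DFunLike.congr_fun (hcomm s) y
    obtain ⟨hs, he⟩ := QFock.apply_cutoff hsa hpos hε (NormedSpace.exp ((s : ℂ) • Complex.I • A) y)
    refine ⟨e ▸ hs, ?_⟩
    have h1 := ((hasDerivAt_exp_smul_const' (𝕂 := ℂ) (Complex.I • A) (s : ℂ)).clm_apply
      (hasDerivAt_const (s : ℂ) (P y))).scomp s Complex.ofRealCLM.hasDerivAt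
    convert! h1 using 1
    have h2 : Complex.ofRealCLM 1 •
        ((Complex.I • A * NormedSpace.exp ((s : ℂ) • Complex.I • A)) (P y) +
        NormedSpace.exp ((s : ℂ) • Complex.I • A) 0) =
        Complex.I • A (NormedSpace.exp ((s : ℂ) • Complex.I • A) (P y)) := by
      simp
    rw [h2]
    simp only [e]
    rw [he]

end Resolvent

/-! ### Creation operators as elements of `M_q` -/

section Creation
variable {H : Type*} [NormedAddCommGroup H] [InnerProductSpace ℂ H]

theorem creation_coe (q : Set.Ioo (-1 : ℝ) 1) (f : H) (x : AlgFock q H) :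
    creation q f x = (algCreation q f x : FockSpace q H) := by
  simp [creation]

theorem algCreation_add (q : Set.Ioo (-1 : ℝ) 1) (f g : H) (x : AlgFock q H) :
    algCreation q (f + g) x = algCreation q f x + algCreation q g x := by
  simp [algCreation, add_mul]

theorem algCreation_smul (q : Set.Ioo (-1 : ℝ) 1) (c : ℂ) (f : H) (x : AlgFock q H) :
    algCreation q (c • f) x = c • algCreation q f x := by
  simp [algCreation]

theorem norm_creation_le (q : Set.Ioo (-1 : ℝ) 1) (f : H) :
    ‖creation q f‖ ≤ √(1 / (1 - |(q : ℝ)|)) * ‖f‖ := by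
  refine ContinuousLinearMap.opNorm_le_bound _ (by positivity) fun x => ?_
  induction x using UniformSpace.Completion.induction_on with
  | hp => exact isClosed_le (by fun_prop) (by fun_prop)
  | ih x =>
    rw [creation_coe, UniformSpace.Completion.norm_coe, UniformSpace.Completion.norm_coe]
    refine (norm_algCreation_le f x).trans_eq ?_
    rw [div_eq_mul_one_div, Real.sqrt_mul (by positivity), Real.sqrt_sq (norm_nonneg f),
      mul_comm ‖f‖]

theorem fockSpace_ext {q : Set.Ioo (-1 : ℝ) 1} {A B : FockSpace q H →L[ℂ] FockSpace q H}
    (h : ∀ x : AlgFock q H, A x = B x) : A = B := by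
  ext x
  induction x using UniformSpace.Completion.induction_on with
  | hp => exact isClosed_eq (ContinuousLinearMap.continuous _) (ContinuousLinearMap.continuous _)
  | ih x => exact h x

theorem creation_add (q : Set.Ioo (-1 : ℝ) 1) (f g : H) :
    creation q (f + g) = creation q f + creation q g :=
  fockSpace_ext fun x => by
    rw [add_apply, creation_coe, creation_coe, creation_coe, algCreation_add,
      UniformSpace.Completion.coe_add]

theorem creation_smul (q : Set.Ioo (-1 : ℝ) 1) (c : ℂ) (f : H) :
    creation q (c • f) = c • creation q f :=
  fockSpace_ext fun x => by
    rw [smul_apply, creation_coe, creation_coe, algCreation_smul,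
      UniformSpace.Completion.coe_smul]

/-- The map `f ↦ a⁺(f)` as a bounded linear map into `M_q`. -/
noncomputable def qCreationCLM (q : Set.Ioo (-1 : ℝ) 1) : H →L[ℂ] qAlgebra q H :=
  LinearMap.mkContinuous
    { toFun := qCreation q
      map_add' := fun f g => Subtype.ext (creation_add q f g)
      map_smul' := fun c f => Subtype.ext (creation_smul q c f) }
    (√(1 / (1 - |(q : ℝ)|))) fun f => norm_creation_le q f

theorem annihilation_coe (q : Set.Ioo (-1 : ℝ) 1) (f : H) (x : AlgFock q H) :
    annihilation q f x = (algAnnihilation q f x : FockSpace q H) := by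
  refine ext_inner_left ℂ fun y => ?_
  induction y using UniformSpace.Completion.induction_on with
  | hp => exact isClosed_eq (by fun_prop) (by fun_prop)
  | ih y =>
    rw [annihilation, ContinuousLinearMap.adjoint_inner_right, creation_coe,
      UniformSpace.Completion.inner_coe, UniformSpace.Completion.inner_coe, inner_algCreation_left]

theorem annihilation_mul_creation (q : Set.Ioo (-1 : ℝ) 1) (f g : H) :
    annihilation q f * creation q g =
      ⟪f, g⟫_ℂ • 1 + ((q : ℝ) : ℂ) • (creation q g * annihilation q f) :=
  fockSpace_ext fun x => by
    rw [add_apply, smul_apply,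
      smul_apply, mul_apply_eq_comp, mul_apply_eq_comp, one_apply_eq_self,
      creation_coe, annihilation_coe, annihilation_coe, creation_coe, algAnnihilation_algCreation,
      UniformSpace.Completion.coe_add, UniformSpace.Completion.coe_smul,
      UniformSpace.Completion.coe_smul]

/-- The `q`-commutation relation in `M_q`. -/
theorem qAnnihilation_mul_qCreation (q : Set.Ioo (-1 : ℝ) 1) (f g : H) :
    qAnnihilation q f * qCreation q g =
      ⟪f, g⟫_ℂ • 1 + ((q : ℝ) : ℂ) • (qCreation q g * qAnnihilation q f) :=
  Subtype.ext (annihilation_mul_creation q f g)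

theorem dynamics_qCreation (q : Set.Ioo (-1 : ℝ) 1) (U : UnitaryGroup H) (t : ℝ) (g : H) :
    dynamics q U t (qCreation q g) = qCreation q (U t g) := by
  refine Subtype.ext ?_
  change gamma q (U t) * creation q g * star (gamma q (U t)) = creation q (U t g)
  rw [gamma_mul_creation, star_gamma, mul_assoc, gamma_mul_symm, mul_one]

end Creation

/-! ### The two-point functions of a KMS state -/

section KMS
variable {H : Type*} [NormedAddCommGroup H] [InnerProductSpace ℂ H]

/-- The functional `g ↦ ω(a(f) a⁺(g))`. -/
noncomputable def twoPointLeft {q : Set.Ioo (-1 : ℝ) 1} (ω : qAlgebra q H →L[ℂ] ℂ) (f : H) :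
    H →L[ℂ] ℂ :=
  ω ∘L ContinuousLinearMap.mul ℂ (qAlgebra q H) (qAnnihilation q f) ∘L qCreationCLM q

/-- The functional `g ↦ ω(a⁺(g) a(f))`. -/
noncomputable def twoPointRight {q : Set.Ioo (-1 : ℝ) 1} (ω : qAlgebra q H →L[ℂ] ℂ) (f : H) :
    H →L[ℂ] ℂ :=
  ω ∘L (ContinuousLinearMap.mul ℂ (qAlgebra q H)).flip (qAnnihilation q f) ∘L qCreationCLM q

theorem twoPointLeft_apply {q : Set.Ioo (-1 : ℝ) 1} (ω : qAlgebra q H →L[ℂ] ℂ) (f g : H) :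
    twoPointLeft ω f g = ω (qAnnihilation q f * qCreation q g) := rfl

theorem twoPointRight_apply {q : Set.Ioo (-1 : ℝ) 1} (ω : qAlgebra q H →L[ℂ] ℂ) (f g : H) :
    twoPointRight ω f g = ω (qCreation q g * qAnnihilation q f) := rfl

/-- The KMS condition for one creation and one annihilation operator:
`ω(a(f) a⁺(e^{-βh} g)) = ω(a⁺(g) a(f))`. For `g` in the range of a cutoff, the function
`z ↦ ω(a(f) a⁺(e^{izh} g))` is entire and has the same values on the real line as the function given
by the KMS condition, so the two agree at `iβ` as well. -/
theorem twoPointLeft_comp_expNeg [CompleteSpace H] {q : Set.Ioo (-1 : ℝ) 1} {U : UnitaryGroup H}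
    (hsa : IsSelfAdjoint U.generator) (hpos : IsStrictlyPositive U.generator) {β : ℝ} (hβ : 0 < β)
    {ω : qAlgebra q H →L[ℂ] ℂ} (hKMS : IsKMS U β ω) (f : H) :
    twoPointLeft ω f ∘L expNeg β hsa hpos = twoPointRight ω f := by
  refine eq_of_eqOn_cutoff hsa hpos fun ε hε y => ?_
  set A := truncation hsa hpos ε
  set x := cutoff hsa hpos ε y
  obtain ⟨F, hFd, hFc, hF⟩ := hKMS (qAnnihilation q f) (qCreation q x)
  have hG : Differentiable ℂ fun z : ℂ =>
      twoPointLeft ω f (NormedSpace.exp (z • Complex.I • A) x) := by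
    intro z
    have h1 := (hasDerivAt_exp_smul_const (𝕂 := ℂ) (Complex.I • A) z).differentiableAt
    exact (twoPointLeft ω f).differentiableAt.comp z
      (h1.clm_apply (differentiableAt_const x))
  have h1 := eq_zero_of_boundary_eq_zero hβ
    (K := fun z => F z - twoPointLeft ω f (NormedSpace.exp (z • Complex.I • A) x))
    (hFd.sub hG.differentiableOn) (hFc.sub hG.continuous.continuousOn) fun t => by
      rw [(hF t).1, dynamics_qCreation, ← twoPointLeft_apply, U.apply_cutoff hsa hpos hε, sub_self]
  have h2 := (hF 0).2
  have h00 : U 0 x = x := DFunLike.congr_fun U.map_zero' x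
  rw [Complex.ofReal_zero, zero_add, dynamics_qCreation, h00, ← twoPointRight_apply] at h2
  rw [← h2, sub_eq_zero.1 h1]
  have h3 : (β * Complex.I) • Complex.I • A = (-β : ℝ) • A := by
    rw [smul_smul, mul_assoc, Complex.I_mul_I, mul_neg_one, ← Complex.ofReal_neg, Complex.coe_smul]
  rw [h3]
  exact congrArg (twoPointLeft ω f)
    (DFunLike.congr_fun (exp_truncation_mul_cutoff hsa hpos hβ hε) y).symm

end KMS
end QFock

theorem propositionp1 {H : Type*} [NormedAddCommGroup H] [InnerProductSpace ℂ H] [CompleteSpace H]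
    (q : Set.Ioo (-1 : ℝ) 1) (h : H →ₗ.[ℂ] H) (hsa : IsSelfAdjoint h)
    (hpos : QFock.IsStrictlyPositive h)
    (U : QFock.UnitaryGroup H) (hU : U.generator = h)
    (β : ℝ) (hβ : 0 < β)
    (ω : QFock.qAlgebra q H →L[ℂ] ℂ) (hω : QFock.IsState ω) (hKMS : QFock.IsKMS U β ω) :
    IsUnit (1 - ((q : ℝ) : ℂ) • QFock.expNeg β hsa hpos) ∧
    ∀ f g : H,
      ω (QFock.qAnnihilation q f * QFock.qCreation q g) =
        ⟪f, Ring.inverse (1 - ((q : ℝ) : ℂ) • QFock.expNeg β hsa hpos) g⟫_ℂ ∧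
      ω (QFock.qCreation q f * QFock.qAnnihilation q g) =
        ⟪g, (QFock.expNeg β hsa hpos *
          Ring.inverse (1 - ((q : ℝ) : ℂ) • QFock.expNeg β hsa hpos)) f⟫_ℂ := by
  subst hU
  set E := QFock.expNeg β hsa hpos
  -- Neumann series, as `‖e^{-βh}‖ ≤ 1`.
  have hunit : IsUnit (1 - ((q : ℝ) : ℂ) • E) := by
    refine isUnit_one_sub_of_norm_lt_one ?_
    rw [norm_smul, Complex.norm_real, Real.norm_eq_abs]
    exact (mul_le_of_le_one_right (abs_nonneg _) (QFock.norm_expNeg_le hsa hpos hβ)).trans_lt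
      (abs_lt.2 q.2)
  have hkms : ∀ f g, QFock.twoPointLeft ω f (E g) = QFock.twoPointRight ω f g := fun f g =>
    DFunLike.congr_fun (QFock.twoPointLeft_comp_expNeg hsa hpos hβ hKMS f) g
  have hccr : ∀ f g, QFock.twoPointLeft ω f ((1 - ((q : ℝ) : ℂ) • E) g) = ⟪f, g⟫_ℂ := by
    intro f g
    have h1 := congrArg ω (QFock.qAnnihilation_mul_qCreation q f g)
    rw [map_add, map_smul, map_smul, hω.map_one, ← QFock.twoPointLeft_apply,
      ← QFock.twoPointRight_apply, ← hkms] at h1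
    change QFock.twoPointLeft ω f (g - ((q : ℝ) : ℂ) • E g) = _
    rw [map_sub, map_smul, h1]
    simp
  have hleft : ∀ f g, QFock.twoPointLeft ω f g = ⟪f, Ring.inverse (1 - ((q : ℝ) : ℂ) • E) g⟫_ℂ := by
    intro f g
    rw [← hccr]
    exact congrArg _ (DFunLike.congr_fun (Ring.mul_inverse_cancel _ hunit) g).symm
  have hcomm : Commute (Ring.inverse (1 - ((q : ℝ) : ℂ) • E)) E := by
    have h1 : Commute E (1 - ((q : ℝ) : ℂ) • E) :=
      (Commute.one_right E).sub_right ((Commute.refl E).smul_right _)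
    obtain ⟨u, hu⟩ := hunit
    rw [← hu] at h1 ⊢
    rw [Ring.inverse_unit]
    exact h1.symm.units_inv_left
  refine ⟨hunit, fun f g => ⟨hleft f g, ?_⟩⟩
  rw [← QFock.twoPointRight_apply, ← hkms, hleft, ← hcomm.eq]
  rfl
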